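/- Let $n\ge 1$. A smooth convex body in $\mathbb R^n$ is a compact convex set with non-empty interior and $C^\infty$ boundary; $B$ is the Euclidean unit ball, $h_T(u)=\sup_{x\in T}\langle x,u\rangle$ the support function of $T$, $K_1+K_2$ the Minkowski sum, and $N_K(x)=\{u:\langle u,x-y\rangle\ge 0\ \ \forall y\in K\}$ the outward normal cone of $K$ at $x$. For convex bodies $K,T\subset\mathbb R^n$, a closed $(K,T)$-billiard trajectory is a piecewise smooth loop $(q,p):S^1\to\partial(K\times T)$ (continuous, with left and right derivatives everywhere, and $C^\infty$ outside a closed null set) such that at every time both one-sided derivatives $(\dot q,\dot p)$ are non-zero and satisfy $-\dot q\in N_T(p)$, $\dot p\in N_K(q)$; gliding along the boundary is allowed. The closed curve $q$ is then called a $T$-billiard trajectory in $K$, and its length is $\int_{S^1} h_T(-\dot q)\,dt$ (which equals the action $\tfrac12\int(\langle q,\dot p\rangle-\langle p,\dot q\rangle)\,dt$). Let $\xi_T(K)$ be the smallest length of a $T$-billiard trajectory in $K$. For $T=B$ one obtains the usual billiard trajectories with their Euclidean length, and one writes $\xi(K)=\xi_B(K)$. **Theorem.** Let $K_1,K_2\subset\mathbb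 R^n$ be smooth convex bodies. Then length-minimizing Euclidean billiard trajectories exist in $K_1$, $K_2$ and $K_1+K_2$, and $$\xi(K_1+K_2)\ \ge\ \xi(K_1)+\xi(K_2).$$ Equality holds if and only if there is a closed curve which, up to translation and dilation (by positive factors), is a length-minimizing billiard trajectory in both $K_1$ and $K_2$. Moreover, for every smooth convex body $T\subset\mathbb R^n$, length-minimizing $T$-billiard trajectories exist in $K_1$, $K_2$ and $K_1+K_2$, and $$\xi_T(K_1+K_2)\ \ge\ \xi_T(K_1)+\xi_T(K_2).$$ -/

import Mathlib

open scoped ContDiff Pointwise RealInnerProductSpace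

noncomputable section

/-- A compact convex set with non-empty interior whose boundary is a `C^∞` hypersurface:
near each boundary point the set is `{f ≤ 0}` for a `C^∞` function `f` that is regular
at the point. -/
structure IsSmoothConvexBody {n : ℕ} (K : Set (EuclideanSpace ℝ (Fin n))) : Prop where
  convex : Convex ℝ K
  isCompact : IsCompact K
  nonempty_interior : (interior K).Nonempty
  smooth_boundary : ∀ x ∈ frontier K, ∃ f : EuclideanSpace ℝ (Fin n) → ℝ,
    ContDiff ℝ ∞ f ∧ fderiv ℝ f x ≠ 0 ∧ ∀ᶠ y in nhds x, (y ∈ K ↔ f y ≤ 0)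

/-- The outward normal cone of `K` at `x`. For `x` in a convex body `K` it is `{0}` if `x` is
an interior point, and the ray spanned by the outward normal if `x` is a smooth boundary point. -/
def outwardNormalCone {n : ℕ} (K : Set (EuclideanSpace ℝ (Fin n)))
    (x : EuclideanSpace ℝ (Fin n)) : Set (EuclideanSpace ℝ (Fin n)) :=
  {u | ∀ y ∈ K, 0 ≤ ⟪u, x - y⟫}

/-- The support function `h_T(u) = sup {⟨x, u⟩ : x ∈ T}`. -/
def supportFn {n : ℕ} (T : Set (EuclideanSpace ℝ (Fin n)))
    (u : EuclideanSpace ℝ (Fin n)) : ℝ :=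
  sSup ((fun x => ⟪x, u⟫) '' T)

/-- The admissible velocities of a `(K, T)`-billiard at the point `(q, p)`: the nonzero vectors
`(-a, b)`, where `a` is an outward normal (or zero) of `T` at `p` and `b` is an outward normal
(or zero) of `K` at `q`. So `q` moves along minus the normal of `T` at `p` while `q` is interior
to `K`, and `p` moves along the normal of `K` at `q` while `p` is interior to `T`. -/
def billiardVelocities {n : ℕ} (K T : Set (EuclideanSpace ℝ (Fin n)))
    (q p : EuclideanSpace ℝ (Fin n)) :
    Set (EuclideanSpace ℝ (Fin n) × EuclideanSpace ℝ (Fin n)) :=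
  {v | v ≠ 0 ∧ -v.1 ∈ outwardNormalCone T p ∧ v.2 ∈ outwardNormalCone K q}

/-- `t ↦ (q t, p t)` parametrizes (over the circle `ℝ / ℤ`) a closed `(K, T)`-billiard trajectory:
a piecewise smooth loop in the boundary of `K × T` (it has left and right derivatives at all
times, and is `C^∞` off a closed null set), whose one-sided derivatives are admissible
velocities at all times. Gliding trajectories are allowed. -/
structure IsClosedBilliardTrajectory {n : ℕ} (K T : Set (EuclideanSpace ℝ (Fin n)))
    (q p : ℝ → EuclideanSpace ℝ (Fin n)) : Prop where
  continuous_q : Continuous q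
  continuous_p : Continuous p
  periodic_q : Function.Periodic q 1
  periodic_p : Function.Periodic p 1
  mem_boundary : ∀ t, (q t, p t) ∈ frontier (K ×ˢ T)
  smooth_off_null : ∃ F : Set ℝ, IsClosed F ∧ MeasureTheory.volume F = 0 ∧
    ContDiffOn ℝ ∞ q Fᶜ ∧ ContDiffOn ℝ ∞ p Fᶜ
  deriv_right : ∀ t, ∃ v ∈ billiardVelocities K T (q t) (p t),
    HasDerivWithinAt q v.1 (Set.Ioi t) t ∧ HasDerivWithinAt p v.2 (Set.Ioi t) t
  deriv_left : ∀ t, ∃ v ∈ billiardVelocities K T (q t) (p t),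
    HasDerivWithinAt q v.1 (Set.Iio t) t ∧ HasDerivWithinAt p v.2 (Set.Iio t) t

/-- The closed curve `q` is a (periodic) `T`-billiard trajectory in `K`: the projection to
configuration space of a closed `(K, T)`-billiard trajectory. -/
def IsBilliardTrajectory {n : ℕ} (K T : Set (EuclideanSpace ℝ (Fin n)))
    (q : ℝ → EuclideanSpace ℝ (Fin n)) : Prop :=
  ∃ p : ℝ → EuclideanSpace ℝ (Fin n), IsClosedBilliardTrajectory K T q p

/-- The length of the closed curve `q` measured by `h_T`. The velocity of a `(K, T)`-billiard is
`q' = -a` with `a` an outward normal of `T` at `p`, so that `h_T (-q') = -⟨p, q'⟩`: the sign makes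
the length of the trajectory equal to its action `½ ∫ (⟨q, p'⟩ - ⟨p, q'⟩)`, also for `T ≠ -T`.
If `T` is the Euclidean unit ball, it is the usual length `∫ ‖q'‖`. -/
def billiardLength {n : ℕ} (T : Set (EuclideanSpace ℝ (Fin n)))
    (q : ℝ → EuclideanSpace ℝ (Fin n)) : ℝ :=
  ∫ t in (0 : ℝ)..1, supportFn T (-(deriv q t))

/-- The closed curve `q` is a length-minimizing `T`-billiard trajectory in `K`. -/
def IsShortestBilliardTrajectory {n : ℕ} (K T : Set (EuclideanSpace ℝ (Fin n)))
    (q : ℝ → EuclideanSpace ℝ (Fin n)) : Prop :=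
  IsBilliardTrajectory K T q ∧
    ∀ q' : ℝ → EuclideanSpace ℝ (Fin n), IsBilliardTrajectory K T q' →
      billiardLength T q ≤ billiardLength T q'

/-- `ξ_T(K)`: the `h_T`-length of the shortest periodic `T`-billiard trajectory in `K`. -/
def minkowskiXi {n : ℕ} (T K : Set (EuclideanSpace ℝ (Fin n))) : ℝ :=
  sInf {l | ∃ q, IsBilliardTrajectory K T q ∧ billiardLength T q = l}

/-- The closed Euclidean unit ball of `ℝⁿ`. -/
abbrev euclideanUnitBall (n : ℕ) : Set (EuclideanSpace ℝ (Fin n)) :=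
  Metric.closedBall 0 1

/-- `ξ(K)`: the length of the shortest periodic (Euclidean) billiard trajectory in `K`. -/
def xi {n : ℕ} (K : Set (EuclideanSpace ℝ (Fin n))) : ℝ :=
  minkowskiXi (euclideanUnitBall n) K

end

noncomputable section

open Set Filter Topology MeasureTheory

/-! The key is a variational description of `ξ_T(K)` in the spirit of Bezdek and Bezdek: it is the
least `h_T`-length of a closed polygon with `n + 1` vertices that has no translate inside the
interior of `K` (`minkowskiXi_spec`). This needs `K` and `T` only convex, so it applies directly to
`K₁ + K₂`.

For the upper bound, a shortest such polygon exists by coercivity. Hahn–Banach yields normals of `K`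
at its vertices with sum zero; minimality and a second separation argument turn them into the jumps
of momenta in `T` (`NotTranslatable.exists_isBilliardPolygon`). The resulting billiard polygon is
traced by a piecewise linear loop (`exists_billiard_curve`). For the lower bound, if a trajectory
fitted into the interior of `K` after a translation by `x`, its momentum would drift monotonically
along `-x` and could not close up. Helly's theorem extracts `n + 1` points with the same obstruction
after an arbitrarily small dilation, and the inscribed polygon is no longer than the curve
(`IsRightBilliardLoop.le_billiardLength`).

The inequality follows by scaling. A polygon shorter than `ξ_T(K₁) + ξ_T(K₂)` has proportional
dilates that fit into the interiors of `K₁` and `K₂`, and the two translations add up to one into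
the interior of `K₁ + K₂`. In case of equality the same dilates of a shortest polygon still fit into
the closed bodies and inherit its momenta, so one curve is shortest in both.

Conversely, if `q` and `b • q + y` are shortest in `K₁` and `K₂`, then `(1 + b) • q + y` with the
momentum of `q` is a billiard loop in `K₁ + K₂` of the right length. The difficulty is that the two
momenta may differ while `q` rests at a bounce. Both then make the same total jump, and smoothness
of `K₁` makes its normal cone a ray, so every intermediate velocity of the momentum is normal to
both bodies (`IsRightBilliardLoop.normal_mem_of_homothetic`). -/

abbrev Vec (n : ℕ) := EuclideanSpace ℝ (Fin n)

/-! ### Convex bodies and support functions -/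

/-- A compact convex set with non-empty interior. -/
structure IsConvexBody {n : ℕ} (K : Set (Vec n)) : Prop where
  convex : Convex ℝ K
  isCompact : IsCompact K
  nonempty_interior : (interior K).Nonempty

theorem IsSmoothConvexBody.isConvexBody {n : ℕ} {K : Set (Vec n)} (h : IsSmoothConvexBody K) :
    IsConvexBody K :=
  ⟨h.convex, h.isCompact, h.nonempty_interior⟩

theorem isConvexBody_euclideanUnitBall (n : ℕ) : IsConvexBody (euclideanUnitBall n) where
  convex := convex_closedBall 0 1
  isCompact := isCompact_closedBall 0 1
  nonempty_interior :=
    ⟨0, Metric.ball_subset_interior_closedBall (Metric.mem_ball_self one_pos)⟩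

theorem interior_add_interior_subset {n : ℕ} (K L : Set (Vec n)) :
    interior K + interior L ⊆ interior (K + L) :=
  interior_maximal (Set.add_subset_add interior_subset interior_subset)
    (isOpen_interior.add_right)

namespace IsConvexBody

variable {n : ℕ} {K T : Set (Vec n)}

theorem isClosed (hK : IsConvexBody K) : IsClosed K := hK.isCompact.isClosed

theorem nonempty (hK : IsConvexBody K) : K.Nonempty := hK.nonempty_interior.mono interior_subset

theorem add (hK : IsConvexBody K) (hT : IsConvexBody T) : IsConvexBody (K + T) where
  convex := hK.convex.add hT.convex
  isCompact := hK.isCompact.add hT.isCompact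
  nonempty_interior :=
    (hK.nonempty_interior.add hT.nonempty_interior).mono (interior_add_interior_subset K T)

theorem le_supportFn (hT : IsConvexBody T) {x : Vec n} (hx : x ∈ T) (u : Vec n) :
    ⟪x, u⟫ ≤ supportFn T u := by
  refine le_csSup ?_ (mem_image_of_mem _ hx)
  exact (hT.isCompact.image (by fun_prop)).bddAbove

theorem supportFn_le (hT : IsConvexBody T) {u : Vec n} {c : ℝ} (h : ∀ x ∈ T, ⟪x, u⟫ ≤ c) :
    supportFn T u ≤ c := by
  refine csSup_le (hT.nonempty.image _) ?_
  rintro _ ⟨x, hx, rfl⟩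
  exact h x hx

theorem exists_inner_eq_supportFn (hT : IsConvexBody T) (u : Vec n) :
    ∃ x ∈ T, ⟪x, u⟫ = supportFn T u := by
  obtain ⟨x, hx, h⟩ := hT.isCompact.exists_isMaxOn hT.nonempty
    (f := fun x => ⟪x, u⟫) (by fun_prop)
  exact ⟨x, hx, le_antisymm (hT.le_supportFn hx u) (hT.supportFn_le h)⟩

theorem supportFn_smul (hT : IsConvexBody T) {a : ℝ} (ha : 0 ≤ a) (u : Vec n) :
    supportFn T (a • u) = a * supportFn T u := by
  apply le_antisymm
  · refine hT.supportFn_le fun x hx => ?_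
    rw [inner_smul_right]
    exact mul_le_mul_of_nonneg_left (hT.le_supportFn hx u) ha
  · obtain ⟨x, hx, h⟩ := hT.exists_inner_eq_supportFn u
    rw [← h, ← inner_smul_right]
    exact hT.le_supportFn hx _

theorem supportFn_zero (hT : IsConvexBody T) : supportFn T 0 = 0 := by
  simpa using hT.supportFn_smul le_rfl 0

theorem supportFn_add_le (hT : IsConvexBody T) (u v : Vec n) :
    supportFn T (u + v) ≤ supportFn T u + supportFn T v := by
  refine hT.supportFn_le fun x hx => ?_
  rw [inner_add_right]
  exact add_le_add (hT.le_supportFn hx u) (hT.le_supportFn hx v)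

theorem exists_supportFn_le_norm (hT : IsConvexBody T) :
    ∃ R : NNReal, ∀ u, supportFn T u ≤ R * ‖u‖ := by
  obtain ⟨R, hR⟩ := hT.isCompact.isBounded.exists_norm_le
  refine ⟨R.toNNReal, fun u => hT.supportFn_le fun x hx => ?_⟩
  calc ⟪x, u⟫ ≤ ‖x‖ * ‖u‖ := real_inner_le_norm x u
    _ ≤ _ := by gcongr; exact (hR x hx).trans (Real.le_coe_toNNReal R)

theorem exists_lipschitzWith_supportFn (hT : IsConvexBody T) :
    ∃ R : NNReal, LipschitzWith R (supportFn T) := by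
  obtain ⟨R, hR⟩ := hT.exists_supportFn_le_norm
  refine ⟨R, LipschitzWith.of_le_add_mul R fun u v => ?_⟩
  have h := hT.supportFn_add_le v (u - v)
  rw [add_sub_cancel] at h
  rw [dist_eq_norm]
  linarith [hR (u - v)]

theorem continuous_supportFn (hT : IsConvexBody T) : Continuous (supportFn T) :=
  hT.exists_lipschitzWith_supportFn.choose_spec.continuous

theorem exists_ball (hT : IsConvexBody T) :
    ∃ (c : Vec n) (r : ℝ), 0 < r ∧ ∀ v, ‖v‖ ≤ r → c + v ∈ T := by
  obtain ⟨c, hc⟩ := hT.nonempty_interior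
  obtain ⟨r, hr, h⟩ := Metric.nhds_basis_closedBall.mem_iff.1 (mem_interior_iff_mem_nhds.1 hc)
  refine ⟨c, r, hr, fun v hv => h ?_⟩
  simpa [Metric.mem_closedBall, dist_eq_norm] using hv

/-- If `T` contains the ball of radius `r` around `c`, then `r ‖u‖ ≤ h_T(u) - ⟪c, u⟫`. -/
theorem mul_norm_le_of_ball {c : Vec n} {r : ℝ} (hr : 0 < r)
    (h : ∀ v, ‖v‖ ≤ r → c + v ∈ T) {u : Vec n} {b : ℝ} (hb : ∀ x ∈ T, ⟪x, u⟫ ≤ b) :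
    r * ‖u‖ ≤ b - ⟪c, u⟫ := by
  by_cases hu : u = 0
  · have := hb c (by simpa using h 0 (by simpa using hr.le))
    simp [hu] at this ⊢
    exact this
  have hn : 0 < ‖u‖ := norm_pos_iff.2 hu
  have := hb _ (h ((r / ‖u‖) • u) (by
    rw [norm_smul, Real.norm_of_nonneg (by positivity), div_mul_cancel₀ _ hn.ne']))
  rw [inner_add_left, real_inner_smul_left, real_inner_self_eq_norm_sq] at this
  have e : r / ‖u‖ * ‖u‖ ^ 2 = r * ‖u‖ := by field_simp
  linarith

end IsConvexBody

/-! ### Normal cones -/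

section NormalCone

variable {n : ℕ} {K T : Set (Vec n)} {x u v : Vec n}

theorem smul_mem_outwardNormalCone {a : ℝ} (ha : 0 ≤ a) (hu : u ∈ outwardNormalCone K x) :
    a • u ∈ outwardNormalCone K x := fun y hy => by
  rw [real_inner_smul_left]
  exact mul_nonneg ha (hu y hy)

theorem zero_mem_outwardNormalCone : (0 : Vec n) ∈ outwardNormalCone K x := fun y _ => by simp

theorem mem_outwardNormalCone_of_inner_eq (hT : IsConvexBody T) (h : ⟪x, u⟫ = supportFn T u) :
    u ∈ outwardNormalCone T x := fun y hy => by
  rw [inner_sub_right, sub_nonneg, real_inner_comm, real_inner_comm x, h]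
  exact hT.le_supportFn hy u

/-- A normal is at least `r ‖u‖`-separated from the centre of a ball of radius `r` in `K`. -/
theorem mul_norm_le_inner_of_ball {c : Vec n} {r : ℝ} (hr : 0 < r)
    (h : ∀ w, ‖w‖ ≤ r → c + w ∈ K) (hu : u ∈ outwardNormalCone K x) :
    r * ‖u‖ ≤ ⟪u, x - c⟫ := by
  have := IsConvexBody.mul_norm_le_of_ball (T := K) hr h (u := u) (b := ⟪x, u⟫) fun y hy => by
    have := hu y hy
    rw [inner_sub_right] at this
    rw [real_inner_comm, real_inner_comm u x]
    linarith
  rw [inner_sub_right, real_inner_comm x u, real_inner_comm c u]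
  exact this

theorem inner_pos_of_mem_interior {y : Vec n} (hy : y ∈ interior K)
    (hu : u ∈ outwardNormalCone K x) (hu0 : u ≠ 0) : 0 < ⟪u, x - y⟫ := by
  obtain ⟨r, hr, h⟩ := Metric.nhds_basis_closedBall.mem_iff.1 (mem_interior_iff_mem_nhds.1 hy)
  have := mul_norm_le_inner_of_ball hr (c := y) (K := K) (fun w hw => h (by
    simpa [Metric.mem_closedBall, dist_eq_norm] using hw)) hu
  exact lt_of_lt_of_le (mul_pos hr (norm_pos_iff.2 hu0)) this

theorem notMem_interior_of_normal (hu : u ∈ outwardNormalCone K x) (hu0 : u ≠ 0) :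
    x ∉ interior K := fun hx => by
  simpa using inner_pos_of_mem_interior hx hu hu0

/-- The normal cone at a point of a smooth convex body is contained in a ray. -/
theorem IsSmoothConvexBody.exists_smul_eq (hK : IsSmoothConvexBody K) (hx : x ∈ K)
    (hu : u ∈ outwardNormalCone K x) (hv : v ∈ outwardNormalCone K x) (hv0 : v ≠ 0) :
    ∃ a : ℝ, 0 ≤ a ∧ u = a • v := by
  have hxf : x ∈ frontier K := ⟨subset_closure hx, notMem_interior_of_normal hv hv0⟩
  obtain ⟨f, hf, hf0, hfK⟩ := hK.smooth_boundary x hxf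
  have hd : HasFDerivAt f (fderiv ℝ f x) x :=
    (hf.differentiable (by simp) x).hasFDerivAt
  set g : Vec n := (InnerProductSpace.toDual ℝ (Vec n)).symm (fderiv ℝ f x) with hg
  have hgd : ∀ d, fderiv ℝ f x d = ⟪g, d⟫ := fun d => by
    rw [hg, InnerProductSpace.toDual_symm_apply]
  have hg0 : g ≠ 0 := by
    rw [hg]; simpa using hf0
  have hgg : 0 < ⟪g, g⟫ := real_inner_self_pos.2 hg0
  have hfx : f x ≤ 0 := hfK.self_of_nhds.1 hx
  -- Along such a `d` the function `f` decreases, so `x + s • d` lies in `K` for small `s > 0` and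
  -- can be tested against the normal `w`.
  have inward : ∀ w ∈ outwardNormalCone K x, ∀ d, ⟪g, d⟫ < 0 → ⟪w, d⟫ ≤ 0 := by
    intro w hw d hgd'
    have hl : HasDerivAt (fun s : ℝ => x + s • d) d 0 := by
      simpa using ((hasDerivAt_id (0 : ℝ)).smul_const d).const_add x
    have hc : HasDerivAt (fun s : ℝ => f (x + s • d)) (fderiv ℝ f x d) 0 := by
      have := HasFDerivAt.comp_hasDerivAt (f := fun s : ℝ => x + s • d) (0 : ℝ)
        (l := f) (l' := fderiv ℝ f x) (by simpa using hd) hl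
      exact this
    rw [hgd] at hc
    have h1 : ∀ᶠ s in 𝓝[>] (0 : ℝ), slope (fun s : ℝ => f (x + s • d)) 0 s < 0 :=
      (hasDerivAt_iff_tendsto_slope.1 hc).mono_left
        (nhdsWithin_mono _ (fun s hs => ne_of_gt hs)) |>.eventually (gt_mem_nhds hgd')
    have h2 : ∀ᶠ s in 𝓝[>] (0 : ℝ), (x + s • d ∈ K ↔ f (x + s • d) ≤ 0) := by
      have : Tendsto (fun s : ℝ => x + s • d) (𝓝 0) (𝓝 x) := by
        simpa using hl.continuousAt.tendsto
      exact (this.eventually hfK).filter_mono nhdsWithin_le_nhds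
    obtain ⟨s, hs1, hs2, hs0⟩ := (h1.and (h2.and self_mem_nhdsWithin)).exists
    have hs0 : 0 < s := hs0
    have : f (x + s • d) - f x < 0 := by
      simp only [slope_def_field, sub_zero, zero_smul, add_zero] at hs1
      by_contra hcon
      exact absurd hs1 (not_lt.2 (div_nonneg (not_lt.1 hcon) hs0.le))
    have hm := hw _ (hs2.2 (by linarith))
    rw [sub_add_cancel_left, inner_neg_right, inner_smul_right] at hm
    by_contra hcon
    nlinarith [mul_pos hs0 (not_le.1 hcon)]
  have ray : ∀ w ∈ outwardNormalCone K x, ∃ k : ℝ, 0 ≤ k ∧ w = k • g := by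
    intro w hw
    -- A tangent direction becomes inward when tilted by a small multiple of `-g`; the multiple is
    -- chosen so that the error is at most `ε`.
    have perp : ∀ d, ⟪g, d⟫ = 0 → ⟪w, d⟫ ≤ 0 := by
      intro d hd0
      refine le_of_forall_pos_le_add fun ε hε => ?_
      have hgw : 0 ≤ |⟪w, g⟫| := abs_nonneg _
      have := inward w hw (d - (ε / (|⟪w, g⟫| + 1)) • g) (by
        rw [inner_sub_right, hd0, inner_smul_right]
        have : 0 < ε / (|⟪w, g⟫| + 1) := by positivity
        nlinarith)
      rw [inner_sub_right, inner_smul_right] at this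
      have h3 : ε / (|⟪w, g⟫| + 1) * ⟪w, g⟫ ≤ ε := by
        rw [div_mul_eq_mul_div, div_le_iff₀ (by positivity)]
        nlinarith [le_abs_self ⟪w, g⟫]
      linarith
    refine ⟨⟪w, g⟫ / ⟪g, g⟫, div_nonneg ?_ hgg.le, ?_⟩
    · have := inward w hw (-g) (by rw [inner_neg_right]; linarith)
      rw [inner_neg_right] at this
      linarith
    · rw [← sub_eq_zero, ← inner_self_eq_zero (𝕜 := ℝ)]
      set d := w - (⟪w, g⟫ / ⟪g, g⟫) • g with hdd
      have hgd0 : ⟪g, d⟫ = 0 := by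
        rw [hdd, inner_sub_right, inner_smul_right, div_mul_cancel₀ _ hgg.ne', real_inner_comm,
          sub_self]
      have : ⟪d, d⟫ = ⟪w, d⟫ := by
        conv_lhs => rw [hdd]
        rw [inner_sub_left, real_inner_smul_left, ← hdd, hgd0]; ring
      rw [this]
      have h1 := perp d hgd0
      have h2 := perp (-d) (by rw [inner_neg_right, hgd0, neg_zero])
      rw [inner_neg_right] at h2
      linarith
  obtain ⟨k, hk, rfl⟩ := ray u hu
  obtain ⟨l, hl, rfl⟩ := ray v hv
  have hl0 : l ≠ 0 := by rintro rfl; simp at hv0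
  exact ⟨k / l, div_nonneg hk hl, by rw [smul_smul, div_mul_cancel₀ _ hl0]⟩

end NormalCone

/-! ### Shortest polygons that do not fit into the interior, and their momenta -/

/-- The length, measured by `h_T`, of the closed polygon with vertices `v 0, …, v m`. -/
def polygonLength {n m : ℕ} (T : Set (Vec n)) (v : Fin (m + 1) → Vec n) : ℝ :=
  ∑ i, supportFn T (v i - v (i + 1))

/-- No translate of the family `v` lies in the interior of `K`. -/
def NotTranslatable {ι : Type*} {n : ℕ} (K : Set (Vec n)) (v : ι → Vec n) : Prop :=
  ∀ x, ∃ i, v i + x ∉ interior K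

/-- A closed polygon `q` in `K` together with momenta `p` in `T` obeying the reflection law: `p i` is
the momentum on the edge from `q i` to `q (i + 1)`. -/
structure IsBilliardPolygon {n m : ℕ} (K T : Set (Vec n)) (q p : Fin (m + 1) → Vec n) : Prop where
  mem_left : ∀ i, q i ∈ K
  mem_right : ∀ i, p i ∈ T
  normal_right : ∀ i, q i - q (i + 1) ∈ outwardNormalCone T (p i)
  normal_left : ∀ i, p i - p (i - 1) ∈ outwardNormalCone K (q i)
  exists_ne : ∃ i, q i ≠ q (i + 1)

section Polygon

variable {n m : ℕ} {K T : Set (Vec n)} {v : Fin (m + 1) → Vec n}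

/-- Addition in `Fin (m + 1)` wraps around, so the last vertex is followed by vertex `0` and the
polygon closes. -/
theorem sum_sub_add_one (f : Fin (m + 1) → Vec n) : ∑ i, (f i - f (i + 1)) = 0 := by
  rw [Finset.sum_sub_distrib, sub_eq_zero]
  exact (Equiv.sum_comp (Equiv.addRight (1 : Fin (m + 1))) f).symm

/-- Summation by parts on the cycle. -/
theorem sum_inner_sub_add_one (p v : Fin (m + 1) → Vec n) :
    ∑ i, ⟪p i, v i - v (i + 1)⟫ = ∑ i, ⟪p i - p (i - 1), v i⟫ := by
  simp only [inner_sub_right, inner_sub_left, Finset.sum_sub_distrib]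
  congr 1
  rw [← Equiv.sum_comp (Equiv.addRight (1 : Fin (m + 1))) fun i => ⟪p (i - 1), v i⟫]
  simp

theorem norm_sub_zero_le (v : Fin (m + 1) → Vec n) (i : Fin (m + 1)) :
    ‖v i - v 0‖ ≤ (i : ℕ) * ∑ j, ‖v j - v (j + 1)‖ := by
  induction i using Fin.induction with
  | zero => simp
  | succ i ih =>
    have h1 : ‖v i.castSucc - v (i.castSucc + 1)‖ ≤ ∑ j, ‖v j - v (j + 1)‖ :=
      Finset.single_le_sum (f := fun j => ‖v j - v (j + 1)‖) (fun _ _ => norm_nonneg _)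
        (Finset.mem_univ _)
    rw [Fin.coeSucc_eq_succ, norm_sub_rev] at h1
    have h2 := norm_sub_le_norm_sub_add_norm_sub (v i.succ) (v i.castSucc) (v 0)
    simp only [Fin.val_succ, Fin.val_castSucc] at ih ⊢
    push_cast
    linarith

theorem norm_sub_zero_le_mul (v : Fin (m + 1) → Vec n) (i : Fin (m + 1)) :
    ‖v i - v 0‖ ≤ (m + 1) * ∑ j, ‖v j - v (j + 1)‖ := by
  refine (norm_sub_zero_le v i).trans ?_
  gcongr
  exact_mod_cast i.2.le

/-- If the origin is not in `T`, single edges may have negative `h_T`-length. Recentring `T` at `c`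
changes each edge by a linear term, and these terms cancel around a closed polygon. -/
theorem IsConvexBody.exists_mul_sum_norm_le (hT : IsConvexBody T) :
    ∃ r : ℝ, 0 < r ∧ ∀ v : Fin (m + 1) → Vec n,
      r * ∑ j, ‖v j - v (j + 1)‖ ≤ polygonLength T v := by
  obtain ⟨c, r, hr, h⟩ := hT.exists_ball
  refine ⟨r, hr, fun v => ?_⟩
  have : ∑ j, r * ‖v j - v (j + 1)‖ ≤
      ∑ j, (supportFn T (v j - v (j + 1)) - ⟪c, v j - v (j + 1)⟫) :=
    Finset.sum_le_sum fun j _ =>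
      IsConvexBody.mul_norm_le_of_ball hr h fun x hx => hT.le_supportFn hx _
  rwa [← Finset.mul_sum, Finset.sum_sub_distrib, ← inner_sum, sum_sub_add_one, inner_zero_right,
    sub_zero] at this

theorem IsConvexBody.polygonLength_nonneg (hT : IsConvexBody T) (v : Fin (m + 1) → Vec n) :
    0 ≤ polygonLength T v := by
  obtain ⟨r, hr, h⟩ := hT.exists_mul_sum_norm_le (m := m)
  exact le_trans (mul_nonneg hr.le (Finset.sum_nonneg fun _ _ => norm_nonneg _)) (h v)

theorem IsConvexBody.polygonLength_smul_add (hT : IsConvexBody T) {a : ℝ} (ha : 0 ≤ a) (x : Vec n)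
    (v : Fin (m + 1) → Vec n) :
    polygonLength T (fun i => a • v i + x) = a * polygonLength T v := by
  simp only [polygonLength, Finset.mul_sum]
  refine Finset.sum_congr rfl fun i _ => ?_
  rw [← hT.supportFn_smul ha, add_sub_add_right_eq_sub, smul_sub]

theorem IsConvexBody.continuous_polygonLength (hT : IsConvexBody T) :
    Continuous (polygonLength T : (Fin (m + 1) → Vec n) → ℝ) := by
  have := hT.continuous_supportFn
  unfold polygonLength
  fun_prop

theorem NotTranslatable.add_const {ι : Type*} {v : ι → Vec n} (h : NotTranslatable K v)
    (y : Vec n) : NotTranslatable K (fun i => v i + y) := fun x => by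
  obtain ⟨i, hi⟩ := h (y + x)
  exact ⟨i, by rwa [add_assoc]⟩

theorem isClosed_notTranslatable (K : Set (Vec n)) :
    IsClosed {v : Fin (m + 1) → Vec n | NotTranslatable K v} := by
  have : {v : Fin (m + 1) → Vec n | NotTranslatable K v} =
      ⋂ x, ⋃ i, {v | v i + x ∉ interior K} := by
    ext v; simp [NotTranslatable]
  rw [this]
  refine isClosed_iInter fun x => isClosed_iUnion_of_finite fun i => ?_
  exact isOpen_interior.isClosed_compl.preimage (by fun_prop)

theorem IsConvexBody.exists_notTranslatable (hn : 1 ≤ n) (hm : 1 ≤ m) (hK : IsConvexBody K) :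
    ∃ v : Fin (m + 1) → Vec n, NotTranslatable K v := by
  obtain ⟨R, hR⟩ := hK.isCompact.isBounded.exists_norm_le
  have : Nontrivial (Fin (m + 1)) := Fin.nontrivial_iff_two_le.2 (by omega)
  obtain ⟨i₁, hi₁⟩ := exists_ne (0 : Fin (m + 1))
  -- Two vertices at a distance exceeding `2 * |R|`, hence the diameter of `K`, are enough.
  set w : Vec n := EuclideanSpace.single ⟨0, hn⟩ (2 * |R| + 1) with hw
  have hwn : ‖w‖ = 2 * |R| + 1 := by
    rw [hw, PiLp.norm_single, Real.norm_of_nonneg (by positivity)]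
  refine ⟨fun i => if i = 0 then 0 else w, fun x => ?_⟩
  by_contra! hcon
  have h0 := hR _ (interior_subset (hcon 0))
  have h1 := hR _ (interior_subset (hcon i₁))
  simp only [if_true, if_neg hi₁, zero_add] at h0 h1
  have h2 : ‖w‖ ≤ ‖w + x‖ + ‖x‖ := by simpa using norm_sub_le (w + x) x
  linarith [le_abs_self R]

/-- Among the polygons that cannot be translated into the interior of `K` there is a shortest one,
and its length is positive. -/
theorem IsConvexBody.exists_shortest_polygon (hn : 1 ≤ n) (hm : 1 ≤ m) (hK : IsConvexBody K)
    (hT : IsConvexBody T) :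
    ∃ v : Fin (m + 1) → Vec n, NotTranslatable K v ∧ 0 < polygonLength T v ∧
      ∀ w : Fin (m + 1) → Vec n, NotTranslatable K w → polygonLength T v ≤ polygonLength T w := by
  obtain ⟨r, hr, hrL⟩ := hT.exists_mul_sum_norm_le (m := m)
  -- Pinning a vertex at the origin removes the translations, under which the length is invariant,
  -- and makes the length coercive.
  set C : Set (Fin (m + 1) → Vec n) := {v | NotTranslatable K v} ∩ {v | v 0 = 0} with hC
  have hCc : IsClosed C :=
    (isClosed_notTranslatable K).inter (isClosed_eq (continuous_apply 0) continuous_const)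
  have normalize : ∀ w : Fin (m + 1) → Vec n, NotTranslatable K w →
      ∃ w' ∈ C, polygonLength T w' = polygonLength T w := fun w hw =>
    ⟨fun i => w i + -w 0, ⟨hw.add_const _, by simp⟩, by
      simpa using hT.polygonLength_smul_add zero_le_one (-w 0) w⟩
  obtain ⟨w₀, hw₀⟩ := hK.exists_notTranslatable hn hm
  obtain ⟨v₀, hv₀, -⟩ := normalize w₀ hw₀
  have hcoer : ∀ᶠ v in cocompact (Fin (m + 1) → Vec n) ⊓ 𝓟 C,
      polygonLength T v₀ ≤ polygonLength T v := by
    rw [eventually_inf_principal]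
    filter_upwards [(tendsto_norm_cocompact_atTop (E := Fin (m + 1) → Vec n)).eventually_ge_atTop
      ((m + 1) * (polygonLength T v₀ / r))] with v hv hvC
    have h1 : ‖v‖ ≤ (m + 1) * ∑ j, ‖v j - v (j + 1)‖ := by
      refine (pi_norm_le_iff_of_nonneg
        (mul_nonneg (by positivity) (Finset.sum_nonneg fun _ _ => norm_nonneg _))).2 fun i => ?_
      have h0 : v 0 = 0 := hvC.2
      simpa [h0] using norm_sub_zero_le_mul v i
    have h2 : polygonLength T v₀ / r ≤ ∑ j, ‖v j - v (j + 1)‖ :=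
      le_of_mul_le_mul_left (hv.trans h1) (by positivity)
    rw [div_le_iff₀ hr] at h2
    linarith [hrL v]
  obtain ⟨v, hv, hmin⟩ := hT.continuous_polygonLength.continuousOn.exists_isMinOn' hCc hv₀ hcoer
  refine ⟨v, hv.1, ?_, fun w hw => ?_⟩
  · by_contra hcon
    have h0 : ∑ j, ‖v j - v (j + 1)‖ ≤ 0 := by
      by_contra h
      linarith [hrL v, mul_pos hr (not_le.1 h)]
    obtain ⟨k, hk⟩ := hK.nonempty_interior
    obtain ⟨i, hi⟩ := hv.1 k
    apply hi
    have h1 : ‖v i - v 0‖ ≤ 0 := (norm_sub_zero_le_mul v i).trans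
      (mul_nonpos_of_nonneg_of_nonpos (by positivity) h0)
    have h2 : v 0 = 0 := hv.2
    have h3 : v i = 0 := by simpa [h2] using h1
    simpa [h3] using hk
  · obtain ⟨w', hw', h⟩ := normalize w hw
    exact h ▸ hmin hw'

/-- A polygon that is not longer than every polygon that cannot be translated into the interior
of `K` can be translated into `K`. -/
theorem IsConvexBody.exists_translate_mem (hK : IsConvexBody K) (hT : IsConvexBody T) {l : ℝ}
    (hl : 0 < l) (hmin : ∀ w : Fin (m + 1) → Vec n, NotTranslatable K w → l ≤ polygonLength T w)
    (hv : polygonLength T v ≤ l) : ∃ x, ∀ i, v i + x ∈ K := by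
  -- These dilates are strictly shorter than `l`, so they fit into the interior; compactness of `K`
  -- gives a limit translation.
  have hs : ∀ k : ℕ, ∃ y, ∀ i, (1 - 1 / ((k : ℝ) + 1)) • v i + y ∈ interior K := by
    intro k
    have hk : (0 : ℝ) < 1 / ((k : ℝ) + 1) := by positivity
    have hk1 : 1 / ((k : ℝ) + 1) ≤ 1 := by
      rw [div_le_one (by positivity)]
      linarith [(Nat.cast_nonneg k : (0 : ℝ) ≤ k)]
    by_contra! hcon
    have h1 := hmin (fun i => (1 - 1 / ((k : ℝ) + 1)) • v i + 0) fun x => by simpa using hcon x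
    rw [hT.polygonLength_smul_add (by linarith)] at h1
    nlinarith [hT.polygonLength_nonneg v]
  choose y hy using hs
  obtain ⟨a, -, φ, hφ, ha⟩ := hK.isCompact.tendsto_subseq fun k => interior_subset (hy k 0)
  refine ⟨a - v 0, fun i => ?_⟩
  have hlim : Tendsto (fun k : ℕ => 1 - 1 / ((φ k : ℝ) + 1)) atTop (𝓝 (1 - 0)) :=
    (tendsto_one_div_add_atTop_nhds_zero_nat.comp hφ.tendsto_atTop).const_sub 1
  have h2 := ha.add (hlim.smul_const (v i - v 0))
  rw [sub_zero, one_smul] at h2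
  have e : v i + (a - v 0) = a + (v i - v 0) := by abel
  rw [e]
  refine hK.isClosed.mem_of_tendsto h2 (Eventually.of_forall fun k => ?_)
  have := interior_subset (hy (φ k) i)
  convert this using 1
  simp only [Function.comp, smul_sub]
  abel

/-- A polygon separated from the interior of `K` by a family of vectors with sum zero cannot be
translated into the interior. -/
theorem notTranslatable_of_sum_lt {ν : Fin (m + 1) → Vec n} (hν : ∑ i, ν i = 0) {u : ℝ}
    (hu : ∀ c : Fin (m + 1) → Vec n, (∀ i, c i ∈ interior K) → ∑ i, ⟪ν i, c i⟫ < u)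
    (hv : u ≤ ∑ i, ⟪ν i, v i⟫) : NotTranslatable K v := by
  intro x
  by_contra! hcon
  have := hu _ hcon
  simp only [inner_add_right, Finset.sum_add_distrib, ← sum_inner, hν, inner_zero_left,
    add_zero] at this
  linarith

theorem exists_sum_inner_eq (f : StrongDual ℝ (Fin (m + 1) → Vec n)) :
    ∃ ν : Fin (m + 1) → Vec n, ∀ v, f v = ∑ i, ⟪ν i, v i⟫ := by
  refine ⟨fun i => (InnerProductSpace.toDual ℝ (Vec n)).symm
    (f.comp (ContinuousLinearMap.single ℝ (fun _ => Vec n) i)), fun v => ?_⟩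
  conv_lhs => rw [← Finset.univ_sum_single v, map_sum]
  refine Finset.sum_congr rfl fun i _ => ?_
  rw [InnerProductSpace.toDual_symm_apply]
  simp

/-- Hahn–Banach in the space of all vertex families separates the open product of the interiors from
the affine space of translates of `v`. A functional bounded below on that affine space is constant
on it, whence the zero sum. -/
theorem NotTranslatable.exists_normals (hK : IsConvexBody K) (hv : NotTranslatable K v) :
    ∃ (ν : Fin (m + 1) → Vec n) (u : ℝ), ∑ i, ν i = 0 ∧ u ≤ ∑ i, ⟪ν i, v i⟫ ∧
      ∀ c : Fin (m + 1) → Vec n, (∀ i, c i ∈ interior K) → ∑ i, ⟪ν i, c i⟫ < u := by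
  have hco : Convex ℝ (range fun x : Vec n => fun i => v i + x) := by
    rintro _ ⟨x, rfl⟩ _ ⟨y, rfl⟩ a b _ _ hab
    refine ⟨a • x + b • y, ?_⟩
    ext1 i
    simp only [Pi.add_apply, Pi.smul_apply, smul_add]
    rw [add_add_add_comm, ← add_smul, hab, one_smul]
  obtain ⟨f, u, h1, h2⟩ := geometric_hahn_banach_open
    (s := Set.univ.pi fun _ : Fin (m + 1) => interior K)
    (convex_pi fun _ _ => hK.convex.interior)
    (isOpen_set_pi finite_univ fun _ _ => isOpen_interior) hco (by
      rw [Set.disjoint_left]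
      rintro _ hc ⟨x, rfl⟩
      obtain ⟨i, hi⟩ := hv x
      exact hi (hc i (mem_univ i)))
  obtain ⟨ν, hν⟩ := exists_sum_inner_eq f
  have h3 : ∀ x, u ≤ ∑ i, ⟪ν i, v i⟫ + ⟪∑ i, ν i, x⟫ := fun x => by
    have := h2 _ ⟨x, rfl⟩
    rwa [hν, Finset.sum_congr rfl fun i _ => inner_add_right _ _ _, Finset.sum_add_distrib,
      ← sum_inner] at this
  refine ⟨ν, u, ?_, by simpa using h3 0, fun c hc => ?_⟩
  · by_contra hne
    have hpos : 0 < ⟪∑ i, ν i, ∑ i, ν i⟫ := real_inner_self_pos.2 hne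
    -- The translation is scaled so that `h3` reads `u ≤ u - 1`.
    have := h3 (((u - ∑ i, ⟪ν i, v i⟫ - 1) / ⟪∑ i, ν i, ∑ i, ν i⟫) • ∑ i, ν i)
    rw [inner_smul_right, div_mul_cancel₀ _ hpos.ne'] at this
    linarith
  · rw [← hν]
    exact h1 c fun i _ => hc i

/-- A functional dominated by the length is given by the jumps of a cycle of momenta in `T`. -/
theorem IsConvexBody.exists_momenta (hT : IsConvexBody T) {ν : Fin (m + 1) → Vec n}
    (h : ∀ w : Fin (m + 1) → Vec n, ∑ i, ⟪ν i, w i⟫ ≤ polygonLength T w) :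
    ∃ p : Fin (m + 1) → Vec n, (∀ i, p i ∈ T) ∧ ∀ i, p i - p (i - 1) = ν i := by
  let A : (Fin (m + 1) → Vec n) →L[ℝ] (Fin (m + 1) → Vec n) :=
    ContinuousLinearMap.pi fun i =>
      ContinuousLinearMap.proj (R := ℝ) (φ := fun _ => Vec n) i -
        ContinuousLinearMap.proj (R := ℝ) (φ := fun _ => Vec n) (i - 1)
  have hA : ∀ p i, A p i = p i - p (i - 1) := fun _ _ => rfl
  by_cases hmem : ν ∈ A '' (Set.univ.pi fun _ => T)
  · obtain ⟨p, hp, rfl⟩ := hmem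
    exact ⟨p, fun i => hp i (mem_univ i), fun i => (hA p i).symm⟩
  exfalso
  have hcomp : IsCompact (A '' (Set.univ.pi fun _ => T)) :=
    (isCompact_univ_pi fun _ => hT.isCompact).image A.continuous
  obtain ⟨f, u, h1, h2⟩ := geometric_hahn_banach_closed_point
    (Convex.linear_image (convex_pi fun _ _ => hT.convex) A.toLinearMap) hcomp.isClosed hmem
  obtain ⟨w, hw⟩ := exists_sum_inner_eq f
  -- With momenta that realise the support function on each edge of `w`, summation by parts makes `f
  -- (A p)` the length of `w`, so separation contradicts the domination of `ν` by the length.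
  choose p hpT hp using fun i => hT.exists_inner_eq_supportFn (w i - w (i + 1))
  have h3 := h1 _ ⟨p, fun i _ => hpT i, rfl⟩
  have h4 : f (A p) = polygonLength T w := by
    rw [hw, polygonLength]
    simp_rw [← hp]
    rw [sum_inner_sub_add_one]
    exact Finset.sum_congr rfl fun i _ => by rw [real_inner_comm]; rfl
  have h5 : f ν = ∑ i, ⟪ν i, w i⟫ := by
    rw [hw]
    exact Finset.sum_congr rfl fun i _ => real_inner_comm _ _
  change f (A p) < u at h3
  linarith [h w]

/-- A shortest polygon that cannot be translated into the interior of `K` is, up to a translation,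
a billiard polygon. -/
theorem NotTranslatable.exists_isBilliardPolygon (hK : IsConvexBody K) (hT : IsConvexBody T)
    (hv : NotTranslatable K v) (hpos : 0 < polygonLength T v)
    (hmin : ∀ w : Fin (m + 1) → Vec n, NotTranslatable K w →
      polygonLength T v ≤ polygonLength T w) :
    ∃ (x : Vec n) (p : Fin (m + 1) → Vec n), IsBilliardPolygon K T (fun i => v i + x) p := by
  obtain ⟨ν, u, hν, huv, hu⟩ := hv.exists_normals hK
  obtain ⟨k, hk⟩ := hK.nonempty_interior
  have hu0 : 0 < u := by
    have := hu (fun _ => k) fun _ => hk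
    rwa [← sum_inner, hν, inner_zero_left] at this
  set l := polygonLength T v with hl
  -- This scaling makes the functional given by `ν` lie below the length everywhere and touch it at
  -- `v`.
  set μ := l / u with hμ
  have hμ0 : 0 < μ := div_pos hpos hu0
  have hdom : ∀ w : Fin (m + 1) → Vec n, ∑ i, ⟪μ • ν i, w i⟫ ≤ polygonLength T w := by
    intro w
    simp only [real_inner_smul_left, ← Finset.mul_sum]
    set s := ∑ i, ⟪ν i, w i⟫ with hs
    rcases le_or_gt s 0 with h0 | h0
    · exact le_trans (mul_nonpos_of_nonneg_of_nonpos hμ0.le h0) (hT.polygonLength_nonneg w)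
    -- Dilating `w` until the functional takes the value `u` makes it a competitor in the
    -- minimisation.
    · have h1 := hmin (fun i => (u / s) • w i + 0) (notTranslatable_of_sum_lt hν hu (by
        simp only [add_zero, inner_smul_right, ← Finset.mul_sum]
        rw [← hs, div_mul_cancel₀ _ h0.ne']))
      rw [hT.polygonLength_smul_add (by positivity), div_mul_eq_mul_div, le_div_iff₀ h0] at h1
      rw [hμ, div_mul_eq_mul_div, div_le_iff₀ hu0]
      linarith
  obtain ⟨p, hpT, hp⟩ := hT.exists_momenta hdom
  obtain ⟨x, hx⟩ := hK.exists_translate_mem hT hpos hmin le_rfl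
  have hle : ∑ i, ⟪ν i, v i⟫ = u := by
    have h1 := hdom v
    simp only [real_inner_smul_left, ← Finset.mul_sum] at h1
    rw [← hl, hμ, div_mul_eq_mul_div, div_le_iff₀ hu0] at h1
    exact le_antisymm (le_of_mul_le_mul_left h1 hpos) huv
  have hclosed : ∀ c : Fin (m + 1) → Vec n, (∀ i, c i ∈ K) → ∑ i, ⟪ν i, c i⟫ ≤ u := by
    intro c hc
    have hlim : Tendsto (fun s : ℝ => ∑ i, ⟪ν i, s • k + (1 - s) • c i⟫) (𝓝[>] 0)
        (𝓝 (∑ i, ⟪ν i, (0 : ℝ) • k + (1 - 0 : ℝ) • c i⟫)) :=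
      (Continuous.tendsto (by fun_prop) (0 : ℝ)).mono_left nhdsWithin_le_nhds
    simp only [zero_smul, sub_zero, one_smul, zero_add] at hlim
    refine le_of_tendsto hlim ?_
    filter_upwards [Ioo_mem_nhdsGT (zero_lt_one' ℝ)] with s hs
    refine (hu _ fun i => ?_).le
    exact hK.convex.combo_interior_self_mem_interior hk (hc i) hs.1 (by linarith [hs.2]) (by ring)
  have hsum : ∑ i, ⟪ν i, v i + x⟫ = u := by
    simp only [inner_add_right, Finset.sum_add_distrib, ← sum_inner, hν, inner_zero_left,
      add_zero, hle]
  refine ⟨x, p, hx, hpT, ?_, fun i => ?_, ?_⟩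
  -- Equality of the sums forces equality edge by edge, so each `p i` is extremal for its edge.
  · have h1 : ∑ i, ⟪p i, v i - v (i + 1)⟫ = ∑ i, supportFn T (v i - v (i + 1)) := by
      rw [sum_inner_sub_add_one]
      simp only [hp, real_inner_smul_left, ← Finset.mul_sum, hle]
      rw [hμ, div_mul_cancel₀ _ hu0.ne', hl, polygonLength]
    have h2 := (Finset.sum_eq_sum_iff_of_le fun i _ =>
      hT.le_supportFn (hpT i) (v i - v (i + 1))).1 h1
    intro i
    simp only [add_sub_add_right_eq_sub]
    exact mem_outwardNormalCone_of_inner_eq hT (h2 i (Finset.mem_univ i))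
  · rw [hp]
    refine smul_mem_outwardNormalCone hμ0.le fun y hy => ?_
    -- The translated polygon maximises the functional over families in `K`; varying one vertex
    -- isolates its normal.
    have h1 := hclosed (Function.update (fun j => v j + x) i y) fun j => by
      by_cases hj : j = i
      · subst hj; simpa using hy
      · simpa [hj] using hx j
    have h2 : ∑ j, (⟪ν j, v j + x⟫ - ⟪ν j, Function.update (fun j => v j + x) i y j⟫) =
        ⟪ν i, v i + x - y⟫ := by
      rw [Finset.sum_eq_single i]
      · simp [inner_sub_right]
      · intro j _ hj
        simp [hj]
      · simp
    rw [Finset.sum_sub_distrib, hsum] at h2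
    linarith
  · by_contra! hcon
    simp only [add_left_inj] at hcon
    refine hpos.ne' ?_
    rw [hl, polygonLength]
    exact Finset.sum_eq_zero fun i _ => by rw [← hcon i, sub_self, hT.supportFn_zero]

end Polygon

/-! ### Parametrising closed polygonal paths -/

section PiecewiseLinear

variable {X : Type*} [NormedAddCommGroup X] [NormedSpace ℝ X]

/-- A closed polygonal path with vertices `z 0, …, z N = z 0` is the trace of a piecewise linear loop
over `ℝ / ℤ` with non-zero one-sided velocities; `d j` is the time spent on the `j`-th edge. -/
theorem exists_piecewise_linear_loop (z : ℕ → X) (N : ℕ) (hz : z N = z 0)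
    (hne : ∃ j < N, z (j + 1) ≠ z j) :
    ∃ (Z : ℝ → X) (d : ℕ → ℝ) (F : Set ℝ), (∀ j, 0 < d j → z (j + 1) ≠ z j) ∧ Continuous Z ∧
      Function.Periodic Z 1 ∧ IsClosed F ∧ volume F = 0 ∧ ContDiffOn ℝ ∞ Z Fᶜ ∧
      (∀ t, ∃ j < N, 0 < d j ∧ Z t ∈ segment ℝ (z j) (z (j + 1)) ∧
        HasDerivWithinAt Z ((d j)⁻¹ • (z (j + 1) - z j)) (Ioi t) t) ∧
      (∀ t, ∃ j < N, 0 < d j ∧ Z t ∈ segment ℝ (z j) (z (j + 1)) ∧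
        HasDerivWithinAt Z ((d j)⁻¹ • (z (j + 1) - z j)) (Iio t) t) ∧
      ∀ g : X → ℝ, (∀ c : ℝ, 0 ≤ c → ∀ x, g (c • x) = c * g x) →
        ∫ t in (0 : ℝ)..1, g (deriv Z t) = ∑ j ∈ Finset.range N, g (z (j + 1) - z j) := by
  set D := ∑ j ∈ Finset.range N, ‖z (j + 1) - z j‖ with hD
  have hD0 : 0 < D := by
    obtain ⟨j, hj, hjz⟩ := hne
    exact Finset.sum_pos' (fun _ _ => norm_nonneg _)
      ⟨j, Finset.mem_range.2 hj, norm_pos_iff.2 (sub_ne_zero.2 hjz)⟩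
  -- Time proportional to edge length: degenerate edges take no time, so the velocity never
  -- vanishes.
  set d : ℕ → ℝ := fun j => ‖z (j + 1) - z j‖ / D with hd
  have hd0 : ∀ j, 0 ≤ d j := fun j => by positivity
  set τ : ℕ → ℝ := fun k => ∑ j ∈ Finset.range k, d j with hτ
  have hτs : ∀ k, τ (k + 1) = τ k + d k := fun k => Finset.sum_range_succ _ _
  have hτ0 : τ 0 = 0 := Finset.sum_range_zero _
  have hτN : τ N = 1 := by
    simp only [hτ, hd, ← Finset.sum_div]
    exact div_self hD0.ne'
  have hτm : Monotone τ := monotone_nat_of_le_succ fun k => by rw [hτs]; linarith [hd0 k]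
  set u : ℕ → X := fun j => (d j)⁻¹ • (z (j + 1) - z j) with hu
  -- For a degenerate edge the inverse of `0` is `0`, and both sides vanish.
  have hdu : ∀ j, d j • u j = z (j + 1) - z j := fun j => by
    by_cases hj : d j = 0
    · have : z (j + 1) - z j = 0 := by
        simpa [hd, hD0.ne'] using hj
      rw [hj, this, zero_smul]
    · rw [hu, smul_inv_smul₀ hj]
  -- The clamp is the time already spent on edge `j`: zero before the edge, `d j` after it.
  set G : ℝ → X := fun t => z 0 + ∑ j ∈ Finset.range N, (max 0 (min (t - τ j) (d j))) • u j
    with hG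
  have hGeq : ∀ k < N, ∀ t ∈ Icc (τ k) (τ (k + 1)), G t = z k + (t - τ k) • u k := by
    intro k hk t ht
    have h1 : ∑ j ∈ Finset.range (k + 1), (max 0 (min (t - τ j) (d j))) • u j =
        ∑ j ∈ Finset.range N, (max 0 (min (t - τ j) (d j))) • u j := by
      refine Finset.sum_subset (Finset.range_mono hk) fun j _ hj => ?_
      have : τ (k + 1) ≤ τ j := hτm (by simpa using hj)
      rw [max_eq_left, zero_smul]
      exact (min_le_left _ _).trans (by linarith [ht.2])
    have h2 : ∀ j ∈ Finset.range k, (max 0 (min (t - τ j) (d j))) • u j = z (j + 1) - z j := by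
      intro j hj
      have h3 : τ (j + 1) ≤ τ k := hτm (by simpa using hj)
      rw [hτs] at h3
      rw [min_eq_right (by linarith [ht.1]), max_eq_right (hd0 j), hdu]
    have h4 : max 0 (min (t - τ k) (d k)) = t - τ k := by
      have := ht.2
      rw [hτs] at this
      rw [min_eq_left (by linarith), max_eq_right (by linarith [ht.1])]
    simp only [hG]
    rw [← h1, Finset.sum_range_succ, Finset.sum_congr rfl h2, Finset.sum_range_sub, h4]
    abel
  have findR : ∀ s, 0 ≤ s → s < 1 → ∃ k < N, τ k ≤ s ∧ s < τ (k + 1) := by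
    intro s hs0 hs1
    have hex : ∃ k, s < τ k := ⟨N, by rwa [hτN]⟩
    classical
    have hpos : Nat.find hex ≠ 0 := fun h => by
      have := Nat.find_spec hex
      rw [h, hτ0] at this
      linarith
    obtain ⟨k, hk⟩ := Nat.exists_eq_succ_of_ne_zero hpos
    refine ⟨k, ?_, not_lt.1 (Nat.find_min hex (by omega)), ?_⟩
    · have : Nat.find hex ≤ N := Nat.find_min' hex (by rwa [hτN])
      omega
    · have := Nat.find_spec hex
      rwa [hk] at this
  have findL : ∀ s, 0 < s → s ≤ 1 → ∃ k < N, τ k < s ∧ s ≤ τ (k + 1) := by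
    intro s hs0 hs1
    have hex : ∃ k, s ≤ τ k := ⟨N, by rwa [hτN]⟩
    classical
    have hpos : Nat.find hex ≠ 0 := fun h => by
      have := Nat.find_spec hex
      rw [h, hτ0] at this
      linarith
    obtain ⟨k, hk⟩ := Nat.exists_eq_succ_of_ne_zero hpos
    refine ⟨k, ?_, not_le.1 (Nat.find_min hex (by omega)), ?_⟩
    · have : Nat.find hex ≤ N := Nat.find_min' hex (by rwa [hτN])
      omega
    · have := Nat.find_spec hex
      rwa [hk] at this
  have hG01 : G 1 = G 0 := by
    obtain ⟨k, hk, hk1, hk2⟩ := findL 1 one_pos le_rfl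
    have hkN : k + 1 = N ∨ k + 1 < N := by omega
    have e1 : τ (k + 1) = 1 := le_antisymm (hτN ▸ hτm (by omega)) hk2
    have h1 := hGeq k hk 1 ⟨hk1.le, hk2⟩
    have e2 : 1 - τ k = d k := by rw [← e1, hτs]; ring
    rw [e2, hdu, add_sub_cancel] at h1
    have e3 : z (k + 1) = z N := by
      -- All edges after time `1` is reached are degenerate.
      have hconst : ∀ i, k + 1 ≤ i → i ≤ N → z i = z (k + 1) := by
        intro i hi
        induction i, hi using Nat.le_induction with
        | base => exact fun _ => rfl
        | succ i hi ih =>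
          intro hiN
          rw [← ih (by omega), ← sub_eq_zero, ← hdu]
          have h2 : τ (i + 1) ≤ 1 := hτN ▸ hτm hiN
          have h3 : 1 ≤ τ i := e1 ▸ hτm hi
          rw [hτs] at h2
          rw [le_antisymm (by linarith : d i ≤ 0) (hd0 i), zero_smul]
      exact (hconst N (by omega) le_rfl).symm
    have h0 : G 0 = z 0 := by
      simp only [hG]
      rw [Finset.sum_eq_zero, add_zero]
      intro j _
      have : 0 ≤ τ j := hτ0 ▸ hτm (Nat.zero_le j)
      rw [max_eq_left, zero_smul]
      exact (min_le_left _ _).trans (by linarith)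
    rw [h1, e3, hz, h0]
  set Z : ℝ → X := fun t => G (Int.fract t) with hZ
  have hZG : ∀ (e : ℤ) (t : ℝ), t ∈ Icc (e : ℝ) (e + 1) → Z t = G (t - e) := by
    intro e t ht
    rcases eq_or_lt_of_le ht.2 with h | h
    · have : t = ((e + 1 : ℤ) : ℝ) := by push_cast; exact h
      simp only [hZ]
      rw [this, Int.fract_intCast, ← hG01]
      congr 1
      push_cast
      ring
    · have : ⌊t⌋ = e := Int.floor_eq_iff.2 ⟨ht.1, h⟩
      simp only [hZ]
      rw [← this]
      rfl
  have hZeq : ∀ (e : ℤ) (k : ℕ), k < N → ∀ t ∈ Icc (e + τ k) (e + τ (k + 1)),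
      Z t = z k + (t - e - τ k) • u k := by
    intro e k hk t ht
    have h1 : 0 ≤ τ k := hτ0 ▸ hτm (Nat.zero_le k)
    have h2 : τ (k + 1) ≤ 1 := hτN ▸ hτm hk
    rw [hZG e t ⟨by linarith [ht.1], by linarith [ht.2]⟩]
    exact hGeq k hk _ ⟨by linarith [ht.1], by linarith [ht.2]⟩
  have hseg : ∀ (e : ℤ) (k : ℕ), k < N → 0 < d k → ∀ t ∈ Icc (e + τ k) (e + τ (k + 1)),
      Z t ∈ segment ℝ (z k) (z (k + 1)) := by
    intro e k hk hdk t ht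
    rw [segment_eq_image']
    have h2 := ht.2
    rw [hτs] at h2
    refine ⟨(t - e - τ k) / d k, ⟨div_nonneg (by linarith [ht.1]) hdk.le,
      (div_le_one hdk).2 (by linarith)⟩, ?_⟩
    rw [hZeq e k hk t ht]
    change z k + ((t - e - τ k) / d k) • (z (k + 1) - z k) = _
    rw [← hdu k, smul_smul ((t - e - τ k) / d k), div_mul_cancel₀ _ hdk.ne']
  have hlin : ∀ (e : ℤ) (k : ℕ) (t : ℝ), HasDerivAt (fun t : ℝ => z k + (t - e - τ k) • u k)
      (u k) t := by
    intro e k t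
    have := ((((hasDerivAt_id t).sub_const (e : ℝ)).sub_const (τ k)).smul_const (u k)).const_add
      (z k)
    simpa using this
  have hR : ∀ t, ∃ j < N, 0 < d j ∧ Z t ∈ segment ℝ (z j) (z (j + 1)) ∧
      HasDerivWithinAt Z (u j) (Ioi t) t := by
    intro t
    obtain ⟨k, hk, h1, h2⟩ := findR (Int.fract t) (Int.fract_nonneg t) (Int.fract_lt_one t)
    have h3 : (⌊t⌋ : ℝ) + Int.fract t = t := Int.floor_add_fract t
    have hdk : 0 < d k := by rw [hτs] at h2; linarith
    have hm : t ∈ Icc (⌊t⌋ + τ k) (⌊t⌋ + τ (k + 1)) := ⟨by linarith, by linarith⟩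
    refine ⟨k, hk, hdk, hseg _ k hk hdk t hm, ?_⟩
    refine (hlin ⌊t⌋ k t).hasDerivWithinAt.congr_of_eventuallyEq ?_ (hZeq _ k hk t hm)
    filter_upwards [Ioo_mem_nhdsGT (show t < ⌊t⌋ + τ (k + 1) by linarith)] with s hs
    exact hZeq _ k hk s ⟨by linarith [hs.1, hm.1], hs.2.le⟩
  have hL : ∀ t, ∃ j < N, 0 < d j ∧ Z t ∈ segment ℝ (z j) (z (j + 1)) ∧
      HasDerivWithinAt Z (u j) (Iio t) t := by
    intro t
    -- For left derivatives an integer time has to be seen as the end of the preceding period, so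
    -- the floor is not suitable.
    set e : ℤ := ⌈t⌉ - 1 with he
    have he' : (e : ℝ) = ⌈t⌉ - 1 := by rw [he]; push_cast; ring
    obtain ⟨k, hk, h1, h2⟩ := findL (t - e) (by linarith [Int.ceil_lt_add_one t])
      (by linarith [Int.le_ceil t])
    have hdk : 0 < d k := by rw [hτs] at h2; linarith
    have hm : t ∈ Icc (e + τ k) (e + τ (k + 1)) := ⟨by linarith, by linarith⟩
    refine ⟨k, hk, hdk, hseg _ k hk hdk t hm, ?_⟩
    refine (hlin e k t).hasDerivWithinAt.congr_of_eventuallyEq ?_ (hZeq _ k hk t hm)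
    filter_upwards [Ioo_mem_nhdsLT (show e + τ k < t by linarith)] with s hs
    exact hZeq _ k hk s ⟨hs.1.le, by linarith [hs.2, hm.2]⟩
  have hopen : ∀ (e : ℤ) (k : ℕ), k < N → ∀ t ∈ Ioo (e + τ k) (e + τ (k + 1)),
      Z =ᶠ[𝓝 t] fun t => z k + (t - e - τ k) • u k := by
    intro e k hk t ht
    filter_upwards [Ioo_mem_nhds ht.1 ht.2] with s hs
    exact hZeq e k hk s (Ioo_subset_Icc_self hs)
  set F : Set ℝ := ⋃ k ∈ Finset.range N, range fun e : ℤ => (e : ℝ) + τ k with hF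
  refine ⟨Z, d, F, fun j hj h => ?_, ?_, ?_, ?_, ?_, ?_, hR, hL, fun g hg => ?_⟩
  · simp [hd, h] at hj
  · refine continuous_iff_continuousAt.2 fun t => ?_
    obtain ⟨j, -, -, -, h1⟩ := hR t
    obtain ⟨k, -, -, -, h2⟩ := hL t
    exact continuousAt_iff_continuous_left'_right'.2
      ⟨h2.continuousWithinAt, h1.continuousWithinAt⟩
  · intro t
    simp only [hZ, Int.fract_add_one]
  · refine isClosed_biUnion_finset fun k _ => ?_
    exact ((Homeomorph.addRight (τ k)).isClosedEmbedding.comp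
      Int.isClosedEmbedding_coe_real).isClosed_range
  · refine Set.Countable.measure_zero ?_ _
    exact (Finset.range N).countable_toSet.biUnion fun k _ => countable_range _
  · intro t ht
    refine ContDiffAt.contDiffWithinAt ?_
    obtain ⟨k, hk, h1, h2⟩ := findR (Int.fract t) (Int.fract_nonneg t) (Int.fract_lt_one t)
    have h3 : (⌊t⌋ : ℝ) + Int.fract t = t := Int.floor_add_fract t
    have h4 : τ k ≠ Int.fract t := fun h => ht (by
      rw [hF]
      exact mem_biUnion (Finset.mem_coe.2 (Finset.mem_range.2 hk)) ⟨⌊t⌋, by simp only [h, h3]⟩)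
    have h5 := lt_of_le_of_ne h1 h4
    refine ContDiffAt.congr_of_eventuallyEq ?_
      (hopen ⌊t⌋ k hk t ⟨by linarith, by linarith⟩)
    fun_prop
  · have hcong : ∀ k < N, EqOn (fun t => g (deriv Z t)) (fun _ => g (u k))
        (Ioo (τ k) (τ (k + 1))) := by
      intro k hk t ht
      have := hopen 0 k hk t (by simpa using ht)
      simp only [this.deriv_eq, (hlin 0 k t).deriv]
    have hint : ∀ k < N, IntervalIntegrable (fun t => g (deriv Z t)) volume (τ k) (τ (k + 1)) := by
      intro k hk
      refine (intervalIntegrable_congr_uIoo (g := fun _ => g (u k)) ?_).2 intervalIntegrable_const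
      rw [uIoo_of_le (hτm (Nat.le_succ k))]
      exact hcong k hk
    have := intervalIntegral.sum_integral_adjacent_intervals hint
    rw [hτ0, hτN] at this
    rw [← this]
    refine Finset.sum_congr rfl fun k hk => ?_
    rw [intervalIntegral.integral_congr_Ioo_of_le (hτm (Nat.le_succ k))
      (hcong k (Finset.mem_range.1 hk)), intervalIntegral.integral_const, hτs, add_sub_cancel_left,
      smul_eq_mul, ← hg _ (hd0 k), hdu]

end PiecewiseLinear

/-! ### From billiard polygons to billiard trajectories -/

section BilliardCurve

variable {n m : ℕ} {K T : Set (Vec n)} {q p : Fin (m + 1) → Vec n}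

theorem mem_frontier_prod {a b : Vec n} (ha : a ∈ K) (hb : b ∈ T)
    (h : a ∉ interior K ∨ b ∉ interior T) : (a, b) ∈ frontier (K ×ˢ T) := by
  refine ⟨subset_closure ⟨ha, hb⟩, ?_⟩
  rw [interior_prod_eq]
  rintro ⟨h1, h2⟩
  exact h.elim (· h1) (· h2)

/-- The vertices of the path of a billiard polygon in `K × T`: bounces (motions of the momentum) at
even indices, edges (motions of the position) at odd indices. -/
def billiardVertex (q p : Fin (m + 1) → Vec n) (j : ℕ) : Vec n × Vec n :=
  (q (Fin.ofNat (m + 1) (j / 2)), p (Fin.ofNat (m + 1) ((j + 1) / 2) - 1))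

theorem fin_ofNat_add_one (m k : ℕ) : Fin.ofNat (m + 1) (k + 1) = Fin.ofNat (m + 1) k + 1 := by
  ext
  simp [Fin.val_add]

theorem fin_ofNat_val {m : ℕ} (i : Fin (m + 1)) : Fin.ofNat (m + 1) i.val = i := by
  ext
  simp

theorem billiardVertex_even (q p : Fin (m + 1) → Vec n) (k : ℕ) :
    billiardVertex q p (2 * k) = (q (Fin.ofNat (m + 1) k), p ((Fin.ofNat (m + 1) k) - 1)) := by
  have h1 : 2 * k / 2 = k := by omega
  have h2 : (2 * k + 1) / 2 = k := by omega
  rw [billiardVertex, h1, h2]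

theorem billiardVertex_odd (q p : Fin (m + 1) → Vec n) (k : ℕ) :
    billiardVertex q p (2 * k + 1) = (q (Fin.ofNat (m + 1) k), p (Fin.ofNat (m + 1) k)) := by
  have h1 : (2 * k + 1) / 2 = k := by omega
  have h2 : (2 * k + 1 + 1) / 2 = k + 1 := by omega
  rw [billiardVertex, h1, h2, fin_ofNat_add_one, add_sub_cancel_right]

theorem billiardVertex_even_succ (q p : Fin (m + 1) → Vec n) (k : ℕ) :
    billiardVertex q p (2 * k + 1 + 1) = (q ((Fin.ofNat (m + 1) k) + 1), p (Fin.ofNat (m + 1) k)) := by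
  rw [show 2 * k + 1 + 1 = 2 * (k + 1) by ring, billiardVertex_even, fin_ofNat_add_one,
    add_sub_cancel_right]

/-- During a bounce the position rests and the non-zero jump is a normal there, which puts the
position on the boundary of `K`. Along an edge the roles of position and momentum are exchanged.
Convexity keeps the moving component in its body. -/
theorem IsBilliardPolygon.edge (hK : IsConvexBody K) (hT : IsConvexBody T) {a : ℝ} (ha : 0 < a)
    {x : Vec n} (h : IsBilliardPolygon K T (fun i => a • q i + x) p) {j : ℕ}
    {y : Vec n × Vec n} (hy : y ∈ segment ℝ (billiardVertex q p j) (billiardVertex q p (j + 1)))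
    (hne : billiardVertex q p (j + 1) ≠ billiardVertex q p j) {e : ℝ} (he : 0 < e) :
    (a • y.1 + x, y.2) ∈ frontier (K ×ˢ T) ∧
      (a • (e • (billiardVertex q p (j + 1) - billiardVertex q p j)).1,
        (e • (billiardVertex q p (j + 1) - billiardVertex q p j)).2) ∈
        billiardVelocities K T (a • y.1 + x) y.2 := by
  rcases Nat.even_or_odd' j with ⟨k, rfl | rfl⟩
  · rw [billiardVertex_odd, billiardVertex_even] at *
    set i := Fin.ofNat (m + 1) k with hi
    have hν : p i - p (i - 1) ≠ 0 := fun h0 => hne (by rw [sub_eq_zero.1 h0])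
    have hy1 : y.1 = q i := by
      obtain ⟨s, t, hs, ht, hst, rfl⟩ := hy
      simp [← add_smul, hst]
    have hy2 : y.2 ∈ T := by
      obtain ⟨s, t, hs, ht, hst, rfl⟩ := hy
      exact hT.convex (h.mem_right _) (h.mem_right _) hs ht hst
    have hN := h.normal_left i
    rw [hy1]
    refine ⟨mem_frontier_prod (h.mem_left i) hy2 (Or.inl (notMem_interior_of_normal hN hν)),
      ?_, ?_, ?_⟩
    · intro h0
      have := congrArg Prod.snd h0
      simp only [Prod.smul_snd, Prod.snd_sub, Prod.snd_zero, smul_eq_zero, he.ne', false_or] at this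
      exact hν this
    · simpa using zero_mem_outwardNormalCone
    · exact smul_mem_outwardNormalCone he.le hN
  · rw [billiardVertex_even_succ, billiardVertex_odd] at *
    set i := Fin.ofNat (m + 1) k with hi
    have hν : q i - q (i + 1) ≠ 0 := fun h0 => hne (by rw [sub_eq_zero.1 h0])
    have hy2 : y.2 = p i := by
      obtain ⟨s, t, hs, ht, hst, rfl⟩ := hy
      simp [← add_smul, hst]
    have hy1 : a • y.1 + x ∈ K := by
      obtain ⟨s, t, hs, ht, hst, rfl⟩ := hy
      have := hK.convex (h.mem_left i) (h.mem_left (i + 1)) hs ht hst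
      convert this using 1
      simp only [Prod.fst_add, Prod.smul_fst, smul_add]
      rw [add_add_add_comm, ← add_smul, hst, one_smul, smul_comm a s, smul_comm a t]
    have hN : a • (q i - q (i + 1)) ∈ outwardNormalCone T (p i) := by
      have := h.normal_right i
      simpa only [add_sub_add_right_eq_sub, ← smul_sub] using this
    rw [hy2]
    refine ⟨mem_frontier_prod hy1 (h.mem_right i)
      (Or.inr (notMem_interior_of_normal hN (smul_ne_zero ha.ne' hν))), ?_, ?_, ?_⟩
    · intro h0
      have := congrArg Prod.fst h0
      simp only [Prod.smul_fst, Prod.fst_sub, Prod.fst_zero, smul_eq_zero, he.ne', ha.ne',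
        false_or] at this
      exact hν (by rw [← neg_sub, this, neg_zero])
    · have := smul_mem_outwardNormalCone he.le hN
      convert this using 1
      simp only [Prod.smul_fst, Prod.fst_sub]
      rw [smul_comm a e, ← smul_neg, ← smul_neg, neg_sub]
    · simpa using zero_mem_outwardNormalCone

theorem hasDerivWithinAt_fst {Z : ℝ → Vec n × Vec n} {v : Vec n × Vec n} {s : Set ℝ} {t : ℝ}
    (h : HasDerivWithinAt Z v s t) : HasDerivWithinAt (fun t => (Z t).1) v.1 s t :=
  (ContinuousLinearMap.fst ℝ (Vec n) (Vec n)).hasFDerivAt.comp_hasDerivWithinAt t h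

theorem hasDerivWithinAt_snd {Z : ℝ → Vec n × Vec n} {v : Vec n × Vec n} {s : Set ℝ} {t : ℝ}
    (h : HasDerivWithinAt Z v s t) : HasDerivWithinAt (fun t => (Z t).2) v.2 s t :=
  (ContinuousLinearMap.snd ℝ (Vec n) (Vec n)).hasFDerivAt.comp_hasDerivWithinAt t h

theorem deriv_smul_add {c : ℝ → Vec n} (a : ℝ) (x : Vec n) (t : ℝ) :
    deriv (fun t => a • c t + x) t = a • deriv c t := by
  rw [deriv_add_const]
  exact deriv_const_smul_field a c

theorem billiardLength_smul_add (hT : IsConvexBody T) {a : ℝ} (ha : 0 ≤ a) (x : Vec n)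
    (c : ℝ → Vec n) : billiardLength T (fun t => a • c t + x) = a * billiardLength T c := by
  simp only [billiardLength, deriv_smul_add, ← smul_neg, hT.supportFn_smul ha]
  exact intervalIntegral.integral_const_mul _ _

theorem sum_range_two_mul (f : ℕ → ℝ) (k : ℕ) :
    ∑ j ∈ Finset.range (2 * k), f j = ∑ i ∈ Finset.range k, (f (2 * i) + f (2 * i + 1)) := by
  induction k with
  | zero => simp
  | succ k ih =>
    rw [show 2 * (k + 1) = 2 * k + 1 + 1 by ring, Finset.sum_range_succ, Finset.sum_range_succ, ih,
      Finset.sum_range_succ, add_assoc]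

/-- The curve traced by a billiard polygon. The same curve serves all the bodies in which a dilated
translate of the polygon is a billiard polygon with the same momenta. -/
theorem exists_billiard_curve (hT : IsConvexBody T) (hq : ∃ i, q i ≠ q (i + 1)) :
    ∃ c P : ℝ → Vec n, ∀ K : Set (Vec n), IsConvexBody K → ∀ (a : ℝ) (x : Vec n), 0 < a →
      IsBilliardPolygon K T (fun i => a • q i + x) p →
      IsClosedBilliardTrajectory K T (fun t => a • c t + x) P ∧
        billiardLength T (fun t => a • c t + x) = a * polygonLength T q := by
  obtain ⟨i, hi⟩ := hq
  obtain ⟨Z, d, F, hd, hcont, hper, hF, hF0, hsmooth, hR, hL, hlen⟩ :=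
    exists_piecewise_linear_loop (billiardVertex q p) (2 * (m + 1))
      (by
        have : Fin.ofNat (m + 1) (m + 1) = Fin.ofNat (m + 1) 0 := by ext; simp
        have h0 := billiardVertex_even q p 0
        rw [← this] at h0
        rw [billiardVertex_even]
        exact h0.symm)
      ⟨2 * i.val + 1, by omega, by
        rw [billiardVertex_even_succ, billiardVertex_odd, fin_ofNat_val]
        exact fun h => hi (congrArg Prod.fst h).symm⟩
  refine ⟨fun t => (Z t).1, fun t => (Z t).2, fun K hK a x ha h => ⟨?_, ?_⟩⟩
  · have key : ∀ (t : ℝ) (s : Set ℝ), (∃ j < 2 * (m + 1), 0 < d j ∧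
        Z t ∈ segment ℝ (billiardVertex q p j) (billiardVertex q p (j + 1)) ∧
        HasDerivWithinAt Z
          ((d j)⁻¹ • (billiardVertex q p (j + 1) - billiardVertex q p j)) s t) →
        ∃ v ∈ billiardVelocities K T (a • (Z t).1 + x) (Z t).2,
          HasDerivWithinAt (fun t => a • (Z t).1 + x) v.1 s t ∧
            HasDerivWithinAt (fun t => (Z t).2) v.2 s t := by
      rintro t s ⟨j, -, hdj, hseg, hder⟩
      refine ⟨_, (h.edge hK hT ha hseg (hd j hdj) (inv_pos.2 hdj)).2, ?_, ?_⟩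
      · exact ((hasDerivWithinAt_fst hder).const_smul a).add_const x
      · have := hasDerivWithinAt_snd hder
        exact this
    have hs1 : ContDiffOn ℝ ∞ (fun t => (Z t).1) Fᶜ := contDiff_fst.comp_contDiffOn hsmooth
    have hs2 : ContDiffOn ℝ ∞ (fun t => (Z t).2) Fᶜ := contDiff_snd.comp_contDiffOn hsmooth
    exact
      { continuous_q := by fun_prop
        continuous_p := by fun_prop
        periodic_q := fun t => by simp only [hper t]
        periodic_p := fun t => by simp only [hper t]
        mem_boundary := fun t => by
          obtain ⟨j, -, hdj, hseg, -⟩ := hR t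
          exact (h.edge hK hT ha hseg (hd j hdj) one_pos).1
        smooth_off_null := ⟨F, hF, hF0,
          (hs1.const_smul a).add contDiffOn_const, hs2⟩
        deriv_right := fun t => key t _ (hR t)
        deriv_left := fun t => key t _ (hL t) }
  · rw [billiardLength_smul_add hT ha.le]
    congr 1
    have h1 : ∀ᵐ t : ℝ, supportFn T (-deriv (fun t => (Z t).1) t) =
        supportFn T (-(deriv Z t).1) := by
      have : ∀ᵐ t : ℝ, t ∉ F := measure_eq_zero_iff_ae_notMem.1 hF0
      filter_upwards [this] with t ht
      have hZt : DifferentiableAt ℝ Z t :=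
        ((hsmooth t ht).contDiffAt (hF.isOpen_compl.mem_nhds ht)).differentiableAt (by simp)
      have := (ContinuousLinearMap.fst ℝ (Vec n) (Vec n)).hasFDerivAt.comp_hasDerivAt t
        hZt.hasDerivAt
      rw [show deriv (fun t => (Z t).1) t = (deriv Z t).1 from this.deriv]
    rw [billiardLength, intervalIntegral.integral_congr_ae (h1.mono fun t ht _ => ht)]
    rw [hlen (fun v => supportFn T (-v.1)) fun c hc v => by
      rw [Prod.smul_fst, ← smul_neg, hT.supportFn_smul hc]]
    -- Pairing each bounce with the following edge: the bounce contributes `h_T(0) = 0`.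
    rw [sum_range_two_mul, polygonLength, Finset.sum_range]
    refine Finset.sum_congr rfl fun k _ => ?_
    rw [billiardVertex_even_succ, billiardVertex_odd, billiardVertex_even, fin_ofNat_val]
    simp [hT.supportFn_zero]

end BilliardCurve

/-! ### Monotonicity from right derivatives -/

section RightDerivative

variable {f : ℝ → ℝ} {a b : ℝ}

theorem le_of_right_deriv_nonneg (hf : ContinuousOn f (Icc a b)) (hab : a ≤ b)
    (h : ∀ t ∈ Ico a b, ∃ f', 0 ≤ f' ∧ HasDerivWithinAt f f' (Ioi t) t) : f a ≤ f b := by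
  choose! f' hf'0 hf' using h
  exact image_le_of_deriv_right_le_deriv_boundary (f := fun _ => f a) (f' := fun _ => 0)
    continuousOn_const (fun x _ => hasDerivWithinAt_const _ _ _) le_rfl hf
    (fun x hx => (hf' x hx).Ici_of_Ioi) hf'0 ⟨hab, le_rfl⟩

theorem lt_of_right_deriv_nonneg_of_pos (hf : ContinuousOn f (Icc a b))
    (h : ∀ t ∈ Ico a b, ∃ f', 0 ≤ f' ∧ HasDerivWithinAt f f' (Ioi t) t)
    (hpos : ∃ t ∈ Ico a b, ∃ f', 0 < f' ∧ HasDerivWithinAt f f' (Ioi t) t) : f a < f b := by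
  obtain ⟨t, ht, f', hf'0, hf'⟩ := hpos
  have h1 : f a ≤ f t := le_of_right_deriv_nonneg (hf.mono (Icc_subset_Icc_right ht.2.le)) ht.1
    fun s hs => h s ⟨hs.1, hs.2.trans ht.2⟩
  have h2 : ∀ᶠ s in 𝓝[>] t, 0 < slope f t s :=
    ((hasDerivWithinAt_iff_tendsto_slope' (lt_irrefl t)).1 hf').eventually (lt_mem_nhds hf'0)
  obtain ⟨s, hs1, hs2⟩ := (h2.and (Ioo_mem_nhdsGT ht.2)).exists
  have h3 : f t < f s := by
    rw [slope_def_field, div_pos_iff_of_pos_right (by linarith [hs2.1])] at hs1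
    linarith
  have h4 : f s ≤ f b := le_of_right_deriv_nonneg
    (hf.mono (Icc_subset_Icc_left (ht.1.trans hs2.1.le))) hs2.2.le
    fun r hr => h r ⟨(ht.1.trans hs2.1.le).trans hr.1, hr.2⟩
  linarith

theorem HasDerivWithinAt.inner_const_left {n : ℕ} {q : ℝ → Vec n} {v : Vec n} {s : Set ℝ} {t : ℝ}
    (h : HasDerivWithinAt q v s t) (y : Vec n) :
    HasDerivWithinAt (fun t => ⟪y, q t⟫) ⟪y, v⟫ s t :=
  (innerSL ℝ y).hasFDerivAt.comp_hasDerivWithinAt t h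

theorem HasDerivWithinAt.inner_const_right {n : ℕ} {q : ℝ → Vec n} {v : Vec n} {s : Set ℝ} {t : ℝ}
    (h : HasDerivWithinAt q v s t) (y : Vec n) :
    HasDerivWithinAt (fun t => ⟪q t, y⟫) ⟪v, y⟫ s t := by
  simp only [real_inner_comm y]
  exact h.inner_const_left y

end RightDerivative

/-! ### Lower bound for the length of billiard loops -/

/-- A loop that satisfies the billiard inclusion for its right derivatives. -/
structure IsRightBilliardLoop {n : ℕ} (K T : Set (Vec n)) (q p : ℝ → Vec n) : Prop where
  continuous_q : Continuous q
  continuous_p : Continuous p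
  periodic_q : Function.Periodic q 1
  periodic_p : Function.Periodic p 1
  mem_right : ∀ t, p t ∈ T
  ae_differentiableAt : ∀ᵐ t, DifferentiableAt ℝ q t
  deriv_right : ∀ t, ∃ v ∈ billiardVelocities K T (q t) (p t),
    HasDerivWithinAt q v.1 (Ioi t) t ∧ HasDerivWithinAt p v.2 (Ioi t) t

section LowerBound

variable {n : ℕ} {K T : Set (Vec n)} {q p : ℝ → Vec n}

theorem IsClosedBilliardTrajectory.mem_prod (hK : IsConvexBody K) (hT : IsConvexBody T)
    (h : IsClosedBilliardTrajectory K T q p) (t : ℝ) : q t ∈ K ∧ p t ∈ T :=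
  (hK.isClosed.prod hT.isClosed).frontier_subset (h.mem_boundary t)

theorem IsClosedBilliardTrajectory.ae_differentiableAt (h : IsClosedBilliardTrajectory K T q p) :
    ∀ᵐ t, DifferentiableAt ℝ q t := by
  obtain ⟨F, hF, hF0, hq, -⟩ := h.smooth_off_null
  filter_upwards [measure_eq_zero_iff_ae_notMem.1 hF0] with t ht
  exact ((hq t ht).contDiffAt (hF.isOpen_compl.mem_nhds ht)).differentiableAt (by simp)

theorem IsClosedBilliardTrajectory.isRightBilliardLoop (hK : IsConvexBody K) (hT : IsConvexBody T)
    (h : IsClosedBilliardTrajectory K T q p) : IsRightBilliardLoop K T q p where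
  continuous_q := h.continuous_q
  continuous_p := h.continuous_p
  periodic_q := h.periodic_q
  periodic_p := h.periodic_p
  mem_right := fun t => (h.mem_prod hK hT t).2
  ae_differentiableAt := h.ae_differentiableAt
  deriv_right := h.deriv_right

/-- With constant momentum `-q'` would always be a non-zero normal at one point `p 0` of `T`, so `q`
would advance strictly in the direction `-(p 0 - c)` and could not return. -/
theorem IsRightBilliardLoop.exists_momentum_moves (hT : IsConvexBody T)
    (h : IsRightBilliardLoop K T q p) :
    ∃ t ∈ Ico (0 : ℝ) 1, ∃ v ∈ billiardVelocities K T (q t) (p t),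
      HasDerivWithinAt q v.1 (Ioi t) t ∧ HasDerivWithinAt p v.2 (Ioi t) t ∧ v.2 ≠ 0 := by
  by_contra! hcon
  have hp : ∀ t ∈ Icc (0 : ℝ) 1, p t = p 0 :=
    constant_of_has_deriv_right_zero h.continuous_p.continuousOn fun t ht => by
      obtain ⟨v, hv, h1, h2⟩ := h.deriv_right t
      rw [← hcon t ht v hv h1 h2]
      exact h2.Ici_of_Ioi
  obtain ⟨c, hc⟩ := hT.nonempty_interior
  have hpos : ∀ t ∈ Ico (0 : ℝ) 1, ∃ f', 0 < f' ∧
      HasDerivWithinAt (fun t => ⟪q t, -(p 0 - c)⟫) f' (Ioi t) t := by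
    intro t ht
    obtain ⟨v, hv, h1, h2⟩ := h.deriv_right t
    refine ⟨_, ?_, h1.inner_const_right _⟩
    have hv1 : -v.1 ≠ 0 := fun h0 => hv.1 (Prod.ext (neg_eq_zero.1 h0) (hcon t ht v hv h1 h2))
    have := inner_pos_of_mem_interior hc hv.2.1 hv1
    rwa [hp t ⟨ht.1, ht.2.le⟩, inner_neg_left, ← inner_neg_right] at this
  have := lt_of_right_deriv_nonneg_of_pos
    (f := fun t => ⟪q t, -(p 0 - c)⟫) (a := 0) (b := 1)
    (by have := h.continuous_q; fun_prop)
    (fun t ht => (hpos t ht).imp fun _ h => ⟨h.1.le, h.2⟩)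
    ⟨0, ⟨le_rfl, one_pos⟩, hpos 0 ⟨le_rfl, one_pos⟩⟩
  have hq := h.periodic_q 0
  rw [zero_add] at hq
  simp only [hq, lt_irrefl] at this

/-- The trace of a billiard trajectory cannot be translated into the interior of the table. -/
theorem IsRightBilliardLoop.notTranslatable (hT : IsConvexBody T)
    (h : IsRightBilliardLoop K T q p) : NotTranslatable K q := by
  intro x
  by_contra! hcon
  -- A normal at `q t` is tested against the interior point `q t + x`; the bound makes `⟪p, -x⟫`
  -- increase around a closed loop.
  have hv : ∀ t, ∀ v ∈ billiardVelocities K T (q t) (p t), v.2 ≠ 0 → 0 < ⟪v.2, -x⟫ := by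
    intro t v hv hv0
    simpa using inner_pos_of_mem_interior (hcon t) hv.2.2 hv0
  obtain ⟨t₀, ht₀, v₀, hv₀, -, hd₀, hne⟩ := h.exists_momentum_moves hT
  have := lt_of_right_deriv_nonneg_of_pos (f := fun t => ⟪p t, -x⟫) (a := 0) (b := 1)
    (by have := h.continuous_p; fun_prop)
    (fun t _ => by
      obtain ⟨v, hvv, -, h2⟩ := h.deriv_right t
      refine ⟨_, ?_, h2.inner_const_right _⟩
      by_cases h0 : v.2 = 0
      · simp [h0]
      · exact (hv t v hvv h0).le)
    ⟨t₀, ht₀, _, hv t₀ v₀ hv₀ hne, hd₀.inner_const_right _⟩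
  have hp := h.periodic_p 0
  rw [zero_add] at hp
  simp only [hp, lt_irrefl] at this

/-- Finitely many points of a loop that cannot be translated into the interior of `K` already cannot
be, once slightly dilated. -/
theorem NotTranslatable.exists_times (hK : IsConvexBody K) (hq : Function.Periodic q 1)
    (h : NotTranslatable K q) {s : ℝ} (hs0 : 0 < s) (hs1 : s < 1) :
    ∃ t : Fin (n + 1) → ℝ, Monotone t ∧ (∀ i, t i ∈ Ico (0 : ℝ) 1) ∧
      NotTranslatable K (fun i => s⁻¹ • q (t i)) := by
  -- Sets of admissible translations. The dilation allows the compact body in place of its interior,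
  -- as compact Helly requires: shrinking `K` towards an interior point brings it into the interior.
  let C : Ico (0 : ℝ) 1 → Set (Vec n) := fun t => {x | s⁻¹ • q t + x ∈ K}
  have hCeq : ∀ t, C t = (Homeomorph.addLeft (s⁻¹ • q t)) ⁻¹' K := fun t => rfl
  have hCc : ∀ t, IsCompact (C t) := fun t => by
    rw [hCeq]
    exact (Homeomorph.isCompact_preimage _).2 hK.isCompact
  have hCv : ∀ t, Convex ℝ (C t) := fun t => hK.convex.translate_preimage_right _
  have hempty : ¬ (⋂ t, C t).Nonempty := by
    rintro ⟨x, hx⟩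
    obtain ⟨k, hk⟩ := hK.nonempty_interior
    obtain ⟨t, ht⟩ := h (s • x + (1 - s) • k)
    obtain ⟨t', ht', heq⟩ := hq.exists_mem_Ico₀ one_pos t
    apply ht
    have h1 : s⁻¹ • q t' + x ∈ K := mem_iInter.1 hx ⟨t', ht'⟩
    have h2 := hK.convex.combo_self_interior_mem_interior h1 hk hs0.le (sub_pos.2 hs1) (by ring)
    rwa [smul_add, smul_inv_smul₀ hs0.ne', add_assoc, ← heq] at h2
  obtain ⟨I, hIc, hI⟩ : ∃ I : Finset (Ico (0 : ℝ) 1), I.card ≤ n + 1 ∧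
      ¬ (⋂ i ∈ I, C i).Nonempty := by
    by_contra! hcon
    refine hempty (Convex.helly_theorem_compact' hCv hCc fun I hI => ?_)
    exact hcon I (by simpa using hI)
  have hIne : Nonempty I := by
    by_contra hne
    have : I = ∅ := by
      rw [Finset.eq_empty_iff_forall_notMem]
      exact fun x hx => hne ⟨⟨x, hx⟩⟩
    exact hI (by simp [this])
  -- Fewer than `n + 1` times are padded by repetition and then sorted.
  obtain ⟨e⟩ : Nonempty (I ↪ Fin (n + 1)) :=
    Function.Embedding.nonempty_of_card_le (by simpa using hIc)
  have hsurj := Function.invFun_surjective e.injective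
  let f : Fin (n + 1) → ℝ := fun i => ((Function.invFun e i : I) : Ico (0 : ℝ) 1)
  refine ⟨f ∘ Tuple.sort f, Tuple.monotone_sort f, fun i => Subtype.property _, fun x => ?_⟩
  by_contra! hcon
  refine hI ⟨x, mem_iInter₂.2 fun i hi => ?_⟩
  obtain ⟨j, hj⟩ := hsurj ⟨i, hi⟩
  have := interior_subset (hcon ((Tuple.sort f).symm j))
  simp only [Function.comp, Equiv.apply_symm_apply, f, hj] at this
  exact this

theorem IsRightBilliardLoop.derivWithin_eq (h : IsRightBilliardLoop K T q p) (t : ℝ) :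
    ∃ w, (derivWithin q (Ioi t) t, w) ∈ billiardVelocities K T (q t) (p t) ∧
      HasDerivWithinAt q (derivWithin q (Ioi t) t) (Ioi t) t := by
  obtain ⟨v, hv, h1, -⟩ := h.deriv_right t
  rw [h1.derivWithin (uniqueDiffWithinAt_Ioi t)]
  exact ⟨v.2, hv, h1⟩

/-- The right velocity of a billiard trajectory is locally integrable. -/
theorem IsRightBilliardLoop.locallyIntegrable (hT : IsConvexBody T)
    (h : IsRightBilliardLoop K T q p) :
    LocallyIntegrable (fun t => derivWithin q (Ioi t) t) volume := by
  obtain ⟨c, r, hr, hball⟩ := hT.exists_ball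
  intro t
  have hnear : ∀ᶠ s in 𝓝 t, ‖p s - p t‖ < r / 2 := by
    have : Tendsto (fun s => ‖p s - p t‖) (𝓝 t) (𝓝 ‖p t - p t‖) :=
      (h.continuous_p.sub continuous_const).norm.tendsto t
    rw [sub_self, norm_zero] at this
    exact this.eventually (gt_mem_nhds (by positivity))
  obtain ⟨a, b, hab, habs⟩ := mem_nhds_iff_exists_Ioo_subset.1 hnear
  -- Freezing the momentum at `t` gives the right derivative of a scalar function. Near `t` it is
  -- non-negative, hence integrable, and it dominates the speed.
  set g' : ℝ → ℝ := fun s => ⟪-derivWithin q (Ioi s) s, p t - c⟫ with hg'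
  have hbound : ∀ s ∈ Ioo a b, r / 2 * ‖derivWithin q (Ioi s) s‖ ≤ g' s := by
    intro s hs
    obtain ⟨w, hw, -⟩ := h.derivWithin_eq s
    have h1 := mul_norm_le_inner_of_ball hr hball hw.2.1
    have h2 := real_inner_le_norm (-derivWithin q (Ioi s) s) (p s - p t)
    have h3 : ‖p s - p t‖ < r / 2 := habs hs
    have h4 : ⟪-derivWithin q (Ioi s) s, p s - c⟫ =
        ⟪-derivWithin q (Ioi s) s, p s - p t⟫ + g' s := by
      rw [hg', ← inner_add_right, sub_add_sub_cancel]
    simp only [norm_neg] at h1 h2 h4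
    nlinarith [norm_nonneg (derivWithin q (Ioi s) s)]
  have hint : IntegrableOn g' (Ioc a b) := by
    refine intervalIntegral.integrableOn_deriv_right_of_nonneg (g := fun s => ⟪-q s, p t - c⟫)
      (by have := h.continuous_q; fun_prop) (fun s _ => ?_) fun s hs =>
        le_trans (by positivity) (hbound s hs)
    obtain ⟨w, -, hd⟩ := h.derivWithin_eq s
    exact hd.neg.inner_const_right _
  refine ⟨Ioo a b, Ioo_mem_nhds hab.1 hab.2, ?_⟩
  refine Integrable.mono' ((hint.mono_set Ioo_subset_Ioc_self).const_mul (2 / r))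
    (measurable_derivWithin_Ioi q).aestronglyMeasurable ?_
  refine (ae_restrict_mem measurableSet_Ioo).mono fun s hs => ?_
  have := hbound s hs
  rw [div_mul_eq_mul_div, le_div_iff₀ hr]
  linarith

theorem IsRightBilliardLoop.intervalIntegrable (hT : IsConvexBody T)
    (h : IsRightBilliardLoop K T q p) (a b : ℝ) :
    IntervalIntegrable (fun t => derivWithin q (Ioi t) t) volume a b :=
  ((h.locallyIntegrable hT).integrableOn_isCompact isCompact_uIcc).intervalIntegrable

theorem IsRightBilliardLoop.intervalIntegrable_supportFn (hT : IsConvexBody T)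
    (h : IsRightBilliardLoop K T q p) (a b : ℝ) :
    IntervalIntegrable (fun t => supportFn T (-derivWithin q (Ioi t) t)) volume a b := by
  obtain ⟨R, hR⟩ := hT.exists_lipschitzWith_supportFn
  refine ((h.intervalIntegrable hT a b).norm.const_mul (R : ℝ)).mono_fun
    (hR.continuous.measurable.comp (measurable_derivWithin_Ioi q).neg).aestronglyMeasurable
    (Eventually.of_forall fun t => ?_)
  have := hR.norm_sub_le (-derivWithin q (Ioi t) t) 0
  rw [hT.supportFn_zero, sub_zero, sub_zero, norm_neg] at this
  exact this.trans (le_abs_self _)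

theorem IsRightBilliardLoop.billiardLength_eq (h : IsRightBilliardLoop K T q p) :
    billiardLength T q = ∫ t in (0 : ℝ)..1, supportFn T (-derivWithin q (Ioi t) t) := by
  refine intervalIntegral.integral_congr_ae ?_
  filter_upwards [h.ae_differentiableAt] with t ht _
  rw [ht.hasDerivAt.hasDerivWithinAt.derivWithin (uniqueDiffWithinAt_Ioi t)]

theorem IsRightBilliardLoop.supportFn_sub_le (hT : IsConvexBody T)
    (h : IsRightBilliardLoop K T q p) {a b : ℝ} (hab : a ≤ b) :
    supportFn T (q a - q b) ≤ ∫ t in a..b, supportFn T (-derivWithin q (Ioi t) t) := by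
  refine hT.supportFn_le fun y hy => ?_
  have hint : IntervalIntegrable (fun t => ⟪y, -derivWithin q (Ioi t) t⟫) volume a b := by
    have := (h.intervalIntegrable hT a b).neg
    exact ⟨this.1.const_inner y, this.2.const_inner y⟩
  have h1 := intervalIntegral.integral_eq_sub_of_hasDeriv_right (f := fun t => ⟪y, -q t⟫)
    (f' := fun t => ⟪y, -derivWithin q (Ioi t) t⟫) (a := a) (b := b)
    (by have := h.continuous_q; fun_prop)
    (fun t _ => (h.derivWithin_eq t).choose_spec.2.neg.inner_const_left y) hint
  have h2 : ⟪y, q a - q b⟫ = ⟪y, -q b⟫ - ⟪y, -q a⟫ := by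
    rw [← inner_sub_right]; congr 1; abel
  rw [h2, ← h1]
  exact intervalIntegral.integral_mono_on hab hint (h.intervalIntegrable_supportFn hT a b)
    fun t _ => hT.le_supportFn hy _

/-- A polygon inscribed in a billiard trajectory is not longer than the trajectory. -/
theorem IsRightBilliardLoop.polygonLength_le {m : ℕ} (hT : IsConvexBody T)
    (h : IsRightBilliardLoop K T q p) {t : Fin (m + 1) → ℝ} (ht : Monotone t)
    (ht01 : ∀ i, t i ∈ Ico (0 : ℝ) 1) :
    polygonLength T (fun i => q (t i)) ≤ billiardLength T q := by
  set l : ℝ → ℝ := fun t => supportFn T (-derivWithin q (Ioi t) t) with hl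
  have hli : ∀ a b, IntervalIntegrable l volume a b := h.intervalIntegrable_supportFn hT
  set L : ℝ → ℝ := fun x => ∫ t in (0 : ℝ)..x, l t with hL
  have hLsub : ∀ a b, ∫ t in a..b, l t = L b - L a := fun a b =>
    (intervalIntegral.integral_interval_sub_left (hli 0 b) (hli 0 a)).symm
  have hseg : ∀ a b, a ≤ b → supportFn T (q a - q b) ≤ L b - L a := fun a b hab =>
    (h.supportFn_sub_le hT hab).trans_eq (hLsub a b)
  have hper : Function.Periodic l 1 := by
    intro s
    simp only [hl]
    obtain ⟨w, -, hd⟩ := h.derivWithin_eq s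
    obtain ⟨w', -, hd'⟩ := h.derivWithin_eq (s + 1)
    have h1 : HasDerivWithinAt (fun r => q (r + 1)) (derivWithin q (Ioi (s + 1)) (s + 1))
        (Ioi s) s := by
      have := HasDerivWithinAt.scomp (h := fun r : ℝ => r + 1) (h' := 1) s hd'
        ((hasDerivWithinAt_id s (Ioi s)).add_const 1) (fun r hr => by simpa using hr)
      rwa [one_smul] at this
    rw [funext h.periodic_q] at h1
    rw [(uniqueDiffWithinAt_Ioi s).eq_deriv _ h1 hd]
  have hloop : L (t 0 + 1) - L (t 0) = billiardLength T q := by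
    rw [← hLsub, h.billiardLength_eq, hper.intervalIntegral_add_eq (t 0) 0, zero_add]
  have h1 : ∀ i : Fin m, supportFn T (q (t i.castSucc) - q (t (i.castSucc + 1))) ≤
      L (t i.succ) - L (t i.castSucc) := fun i => by
    rw [Fin.coeSucc_eq_succ]
    exact hseg _ _ (ht (Fin.castSucc_le_succ i))
  -- The closing edge is compared with the arc that ends one period after `t 0`.
  have h2 : supportFn T (q (t (Fin.last m)) - q (t (Fin.last m + 1))) ≤
      L (t 0 + 1) - L (t (Fin.last m)) := by
    rw [Fin.last_add_one, ← h.periodic_q (t 0)]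
    exact hseg _ _ (by linarith [(ht01 (Fin.last m)).2, (ht01 0).1])
  have h3 : L (t 0) + ∑ i : Fin m, L (t i.succ) =
      ∑ i : Fin m, L (t i.castSucc) + L (t (Fin.last m)) := by
    rw [← Fin.sum_univ_succ fun i => L (t i), ← Fin.sum_univ_castSucc fun i => L (t i)]
  have h4 := Finset.sum_le_sum fun i (_ : i ∈ Finset.univ) => h1 i
  rw [Finset.sum_sub_distrib] at h4
  rw [polygonLength, Fin.sum_univ_castSucc]
  linarith

/-- Billiard trajectories are at least as long as the shortest polygon that cannot be translated into
the interior of the table. -/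
theorem IsRightBilliardLoop.le_billiardLength (hK : IsConvexBody K) (hT : IsConvexBody T)
    (h : IsRightBilliardLoop K T q p) {l : ℝ}
    (hmin : ∀ w : Fin (n + 1) → Vec n, NotTranslatable K w → l ≤ polygonLength T w) :
    l ≤ billiardLength T q := by
  have hs : ∀ s ∈ Ioo (0 : ℝ) 1, s * l ≤ billiardLength T q := by
    intro s hs
    obtain ⟨t, ht, ht01, hnt⟩ := (h.notTranslatable hT).exists_times hK h.periodic_q hs.1 hs.2
    have h1 := hmin _ hnt
    have h2 := hT.polygonLength_smul_add (inv_pos.2 hs.1).le 0 fun i => q (t i)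
    simp only [add_zero] at h2
    rw [h2, inv_mul_eq_div, le_div_iff₀ hs.1, mul_comm] at h1
    exact h1.trans (h.polygonLength_le hT ht ht01)
  have hlim : Tendsto (fun s : ℝ => s * l) (𝓝[<] 1) (𝓝 (1 * l)) :=
    (Continuous.tendsto (by fun_prop) (1 : ℝ)).mono_left nhdsWithin_le_nhds
  rw [one_mul] at hlim
  refine le_of_tendsto hlim ?_
  filter_upwards [Ioo_mem_nhdsLT (zero_lt_one' ℝ)] with s hss
  exact hs s hss

end LowerBound

/-! ### The variational description of the shortest length -/

section Shortest

variable {n : ℕ} {K T : Set (Vec n)}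

theorem IsShortestBilliardTrajectory.minkowskiXi_eq {q : ℝ → Vec n}
    (h : IsShortestBilliardTrajectory K T q) : minkowskiXi T K = billiardLength T q := by
  refine IsLeast.csInf_eq ⟨⟨q, h.1, rfl⟩, ?_⟩
  rintro _ ⟨q', hq', rfl⟩
  exact h.2 q' hq'

/-- `ξ_T(K)` is the smallest length of a polygon with `n + 1` vertices that cannot be translated into
the interior of `K`, and it is attained by a billiard polygon. -/
theorem minkowskiXi_spec (hn : 1 ≤ n) (hK : IsConvexBody K) (hT : IsConvexBody T) :
    0 < minkowskiXi T K ∧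
      (∀ w : Fin (n + 1) → Vec n, NotTranslatable K w → minkowskiXi T K ≤ polygonLength T w) ∧
      ∃ q p : Fin (n + 1) → Vec n, NotTranslatable K q ∧ IsBilliardPolygon K T q p ∧
        polygonLength T q = minkowskiXi T K := by
  obtain ⟨v, hv, hpos, hmin⟩ := hK.exists_shortest_polygon hn hn hT
  obtain ⟨x, p, hp⟩ := hv.exists_isBilliardPolygon hK hT hpos hmin
  have hlen : polygonLength T (fun i => v i + x) = polygonLength T v := by
    simpa using hT.polygonLength_smul_add zero_le_one x v
  obtain ⟨c, P, hc⟩ := exists_billiard_curve (p := p) hT hp.exists_ne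
  obtain ⟨h1, h2⟩ := hc K hK 1 0 one_pos (by simpa using hp)
  rw [one_mul, hlen] at h2
  have hxi : minkowskiXi T K = polygonLength T v := by
    refine (IsShortestBilliardTrajectory.minkowskiXi_eq ⟨⟨P, h1⟩, ?_⟩).trans h2
    rintro q' ⟨p', h'⟩
    rw [h2]
    exact (h'.isRightBilliardLoop hK hT).le_billiardLength hK hT hmin
  rw [hxi]
  exact ⟨hpos, hmin, _, p, hv.add_const x, hp, hlen⟩

theorem IsRightBilliardLoop.minkowskiXi_le (hn : 1 ≤ n) (hK : IsConvexBody K) (hT : IsConvexBody T)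
    {q p : ℝ → Vec n} (h : IsRightBilliardLoop K T q p) :
    minkowskiXi T K ≤ billiardLength T q :=
  h.le_billiardLength hK hT (minkowskiXi_spec hn hK hT).2.1

theorem isShortestBilliardTrajectory_of_length_eq (hn : 1 ≤ n) (hK : IsConvexBody K)
    (hT : IsConvexBody T) {q p : ℝ → Vec n} (h : IsClosedBilliardTrajectory K T q p)
    (hl : billiardLength T q = minkowskiXi T K) : IsShortestBilliardTrajectory K T q := by
  refine ⟨⟨p, h⟩, ?_⟩
  rintro q' ⟨p', h'⟩
  rw [hl]
  exact (h'.isRightBilliardLoop hK hT).minkowskiXi_le hn hK hT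

theorem exists_isShortestBilliardTrajectory (hn : 1 ≤ n) (hK : IsConvexBody K)
    (hT : IsConvexBody T) : ∃ q, IsShortestBilliardTrajectory K T q := by
  obtain ⟨-, -, q, p, -, hp, hlen⟩ := minkowskiXi_spec hn hK hT
  obtain ⟨c, P, hc⟩ := exists_billiard_curve (p := p) hT hp.exists_ne
  obtain ⟨h1, h2⟩ := hc K hK 1 0 one_pos (by simpa using hp)
  exact ⟨_, isShortestBilliardTrajectory_of_length_eq hn hK hT h1 (by rw [h2, hlen, one_mul])⟩

end Shortest

/-! ### The inequality and the forward equality case -/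

section Sum

variable {n : ℕ} {K₁ K₂ T : Set (Vec n)}

/-- Were a shortest polygon of the sum too short, its dilates by `mᵢ / (m₁ + m₂)` would be shorter
than `mᵢ` and fit into the interiors; adding the two translates gives a contradiction. -/
theorem minkowskiXi_add_le (hn : 1 ≤ n) (hK₁ : IsConvexBody K₁) (hK₂ : IsConvexBody K₂)
    (hT : IsConvexBody T) :
    minkowskiXi T K₁ + minkowskiXi T K₂ ≤ minkowskiXi T (K₁ + K₂) := by
  obtain ⟨hp₁, hm₁, -⟩ := minkowskiXi_spec hn hK₁ hT
  obtain ⟨hp₂, hm₂, -⟩ := minkowskiXi_spec hn hK₂ hT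
  obtain ⟨-, -, v, -, hv, -, hlen⟩ := minkowskiXi_spec hn (hK₁.add hK₂) hT
  set m₁ := minkowskiXi T K₁
  set m₂ := minkowskiXi T K₂
  rw [← hlen]
  by_contra! hlt
  have hfit : ∀ (K : Set (Vec n)) (m : ℝ), 0 < m →
      (∀ w : Fin (n + 1) → Vec n, NotTranslatable K w → m ≤ polygonLength T w) →
      ∃ x, ∀ i, (m / (m₁ + m₂)) • v i + x ∈ interior K := by
    intro K m hm hmin
    by_contra! hcon
    have h1 := hmin (fun i => (m / (m₁ + m₂)) • v i + 0) fun x => by simpa using hcon x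
    rw [hT.polygonLength_smul_add (by positivity), div_mul_eq_mul_div,
      le_div_iff₀ (by positivity)] at h1
    exact absurd (le_of_mul_le_mul_left h1 hm) (not_le.2 hlt)
  obtain ⟨x₁, hx₁⟩ := hfit K₁ m₁ hp₁ hm₁
  obtain ⟨x₂, hx₂⟩ := hfit K₂ m₂ hp₂ hm₂
  obtain ⟨i, hi⟩ := hv (x₁ + x₂)
  apply hi
  have := interior_add_interior_subset K₁ K₂ (Set.add_mem_add (hx₁ i) (hx₂ i))
  rwa [add_add_add_comm, ← add_smul, ← add_div, div_self (by positivity), one_smul] at this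

/-- If a billiard polygon in `K₁ + K₂` splits into dilated translates in `K₁` and in `K₂`, then the
first one is a billiard polygon in `K₁`. -/
theorem IsBilliardPolygon.left_of_add {m : ℕ} {q p : Fin (m + 1) → Vec n}
    (h : IsBilliardPolygon (K₁ + K₂) T q p) {a₁ a₂ : ℝ} (ha₁ : 0 < a₁) (ha : a₁ + a₂ = 1)
    {x₁ x₂ : Vec n} (h₁ : ∀ i, a₁ • q i + x₁ ∈ K₁) (h₂ : ∀ i, a₂ • q i + x₂ ∈ K₂) :
    IsBilliardPolygon K₁ T (fun i => a₁ • q i + x₁) p where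
  mem_left := h₁
  mem_right := h.mem_right
  normal_right := fun i => by
    rw [add_sub_add_right_eq_sub, ← smul_sub]
    exact smul_mem_outwardNormalCone ha₁.le (h.normal_right i)
  normal_left := fun i y hy => by
    have hdec : ∀ j, q j = a₁ • q j + a₂ • q j := fun j => by rw [← add_smul, ha, one_smul]
    have h3 : ∀ j, ∀ z ∈ K₁, 0 ≤ ⟪p j - p (j - 1), a₁ • q j - z - x₂⟫ := by
      intro j z hz
      have := h.normal_left j _ (Set.add_mem_add hz (h₂ j))
      rwa [show q j - (z + (a₂ • q j + x₂)) = a₁ • q j - z - x₂ by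
        nth_rewrite 1 [hdec j]
        abel] at this
    have hsum : ∑ j, (p j - p (j - 1)) = 0 := by
      rw [Finset.sum_sub_distrib, sub_eq_zero]
      exact (Equiv.sum_comp (Equiv.subRight (1 : Fin (m + 1))) p).symm
    have h4 : ∑ j, ⟪p j - p (j - 1), x₁ + x₂⟫ = 0 := by
      rw [← sum_inner, hsum, inner_zero_left]
    rw [← Finset.add_sum_erase _ _ (Finset.mem_univ i)] at h4
    -- Every jump pairs non-positively with `x₁ + x₂` while the jumps sum to zero, so the remaining
    -- pairing, at `i`, is also non-negative.
    have h5 : ∑ j ∈ Finset.univ.erase i, ⟪p j - p (j - 1), x₁ + x₂⟫ ≤ 0 := by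
      refine Finset.sum_nonpos fun j _ => ?_
      have := h3 j _ (h₁ j)
      rw [show a₁ • q j - (a₁ • q j + x₁) - x₂ = -(x₁ + x₂) by abel, inner_neg_right] at this
      linarith
    have h6 := h3 i y hy
    rw [show a₁ • q i + x₁ - y = (a₁ • q i - y - x₂) + (x₁ + x₂) by abel, inner_add_right]
    linarith
  exists_ne := by
    obtain ⟨i, hi⟩ := h.exists_ne
    refine ⟨i, fun h0 => hi ?_⟩
    exact smul_right_injective _ ha₁.ne' (add_right_cancel h0)

/-- Under equality the proportional dilates of a shortest polygon of the sum have exactly the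
critical lengths, so they fit into the closed bodies. They share the momenta of the polygon, hence
one curve serves both. -/
theorem exists_common_shortest_of_minkowskiXi_add_eq (hn : 1 ≤ n) (hK₁ : IsConvexBody K₁)
    (hK₂ : IsConvexBody K₂) (hT : IsConvexBody T)
    (heq : minkowskiXi T (K₁ + K₂) = minkowskiXi T K₁ + minkowskiXi T K₂) :
    ∃ (c : ℝ → Vec n) (a₁ a₂ : ℝ) (x₁ x₂ : Vec n), 0 < a₁ ∧ 0 < a₂ ∧
      IsShortestBilliardTrajectory K₁ T (fun t => a₁ • c t + x₁) ∧
      IsShortestBilliardTrajectory K₂ T (fun t => a₂ • c t + x₂) := by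
  obtain ⟨hp₁, hm₁, -⟩ := minkowskiXi_spec hn hK₁ hT
  obtain ⟨hp₂, hm₂, -⟩ := minkowskiXi_spec hn hK₂ hT
  obtain ⟨-, -, q, p, -, hq, hlen⟩ := minkowskiXi_spec hn (hK₁.add hK₂) hT
  rw [heq] at hlen
  have hfit : ∀ K : Set (Vec n), IsConvexBody K → 0 < minkowskiXi T K →
      (∀ w : Fin (n + 1) → Vec n, NotTranslatable K w → minkowskiXi T K ≤ polygonLength T w) →
      ∃ x, ∀ i, (minkowskiXi T K / (minkowskiXi T K₁ + minkowskiXi T K₂)) • q i + x ∈ K := by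
    intro K hK hm hmin
    obtain ⟨x, hx⟩ := hK.exists_translate_mem hT hm hmin
      (v := fun i => (minkowskiXi T K / (minkowskiXi T K₁ + minkowskiXi T K₂)) • q i + 0) (by
        rw [hT.polygonLength_smul_add (by positivity), hlen, div_mul_cancel₀ _ (by positivity)])
    exact ⟨x, by simpa using hx⟩
  obtain ⟨x₁, hx₁⟩ := hfit K₁ hK₁ hp₁ hm₁
  obtain ⟨x₂, hx₂⟩ := hfit K₂ hK₂ hp₂ hm₂
  set s := minkowskiXi T K₁ + minkowskiXi T K₂ with hs
  have hs0 : 0 < s := by positivity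
  have ha₁ : 0 < minkowskiXi T K₁ / s := by positivity
  have ha₂ : 0 < minkowskiXi T K₂ / s := by positivity
  have hsum : minkowskiXi T K₁ / s + minkowskiXi T K₂ / s = 1 := by
    rw [← add_div, div_self hs0.ne']
  have hq₁ := hq.left_of_add ha₁ hsum hx₁ hx₂
  have hq₂ := IsBilliardPolygon.left_of_add (K₁ := K₂) (K₂ := K₁) (by rwa [add_comm]) ha₂
    (by rwa [add_comm]) hx₂ hx₁
  obtain ⟨c, P, hc⟩ := exists_billiard_curve (p := p) hT hq.exists_ne
  obtain ⟨h1, h1'⟩ := hc K₁ hK₁ _ _ ha₁ hq₁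
  obtain ⟨h2, h2'⟩ := hc K₂ hK₂ _ _ ha₂ hq₂
  rw [hlen, div_mul_cancel₀ _ hs0.ne'] at h1' h2'
  exact ⟨c, _, _, x₁, x₂, ha₁, ha₂, isShortestBilliardTrajectory_of_length_eq hn hK₁ hT h1 h1',
    isShortestBilliardTrajectory_of_length_eq hn hK₂ hT h2 h2'⟩

end Sum

/-! ### The converse equality case: adding homothetic trajectories -/

section CommonTrajectory

variable {n : ℕ} {K K₁ K₂ T : Set (Vec n)} {q p p₁ p₂ : ℝ → Vec n}

/-- On a time interval in which the position rests, the momentum moves by a non-zero normal. -/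
theorem IsRightBilliardLoop.normal_of_rest (hK : IsConvexBody K) (h : IsRightBilliardLoop K T q p)
    {α β : ℝ} (hαβ : α < β) {x : Vec n} (hx : ∀ s ∈ Icc α β, q s = x) :
    p β - p α ∈ outwardNormalCone K x ∧ p β - p α ≠ 0 := by
  have key : ∀ s ∈ Ico α β, ∃ w ∈ outwardNormalCone K x, w ≠ 0 ∧
      HasDerivWithinAt p w (Ioi s) s := by
    intro s hs
    obtain ⟨v, hv, h1, h2⟩ := h.deriv_right s
    have h3 : HasDerivWithinAt q 0 (Ioi s) s := by
      refine (hasDerivWithinAt_const s (Ioi s) x).congr_of_eventuallyEq ?_ (hx s ⟨hs.1, hs.2.le⟩)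
      filter_upwards [Ioo_mem_nhdsGT hs.2] with r hr
      exact hx r ⟨hs.1.trans hr.1.le, hr.2.le⟩
    have h4 : v.1 = 0 := (uniqueDiffWithinAt_Ioi s).eq_deriv _ h1 h3
    have h5 := hv.2.2
    rw [hx s ⟨hs.1, hs.2.le⟩] at h5
    exact ⟨v.2, h5, fun h0 => hv.1 (Prod.ext h4 h0), h2⟩
  have hcont : ∀ y, ContinuousOn (fun s => ⟪p s, x - y⟫) (Icc α β) := fun y => by
    have := h.continuous_p
    fun_prop
  constructor
  · intro y hy
    have := le_of_right_deriv_nonneg (hcont y) hαβ.le fun s hs => by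
      obtain ⟨w, hw, -, hd⟩ := key s hs
      exact ⟨_, hw y hy, hd.inner_const_right _⟩
    rw [inner_sub_left]
    linarith
  -- All velocities of the momentum pair positively with `x - k`, so they cannot cancel.
  · obtain ⟨k, hk⟩ := hK.nonempty_interior
    have hpos : ∀ s ∈ Ico α β, ∃ f', 0 < f' ∧
        HasDerivWithinAt (fun s => ⟪p s, x - k⟫) f' (Ioi s) s := by
      intro s hs
      obtain ⟨w, hw, hw0, hd⟩ := key s hs
      exact ⟨_, inner_pos_of_mem_interior hk hw hw0, hd.inner_const_right _⟩
    have := lt_of_right_deriv_nonneg_of_pos (hcont k)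
      (fun s hs => (hpos s hs).imp fun _ h => ⟨h.1.le, h.2⟩)
      ⟨α, ⟨le_rfl, hαβ⟩, hpos α ⟨le_rfl, hαβ⟩⟩
    intro h0
    rw [sub_eq_zero.1 h0] at this
    exact lt_irrefl _ this

/-- Equality case of Cauchy–Schwarz. It makes the direction of motion determine the Euclidean
momentum. -/
theorem eq_of_normal_unitBall {x u : Vec n} (hx : x ∈ euclideanUnitBall n)
    (hu : u ∈ outwardNormalCone (euclideanUnitBall n) x) (hu0 : u ≠ 0) : x = ‖u‖⁻¹ • u := by
  have hn : 0 < ‖u‖ := norm_pos_iff.2 hu0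
  have hx1 : ‖x‖ ≤ 1 := by simpa using hx
  have hun : ‖‖u‖⁻¹ • u‖ = 1 := by
    rw [norm_smul, norm_inv, norm_norm, inv_mul_cancel₀ hn.ne']
  have h1 := hu (‖u‖⁻¹ • u) (by simp [hun])
  have h2 : 1 ≤ ⟪x, ‖u‖⁻¹ • u⟫ := by
    rw [inner_sub_right, inner_smul_right, real_inner_self_eq_norm_sq] at h1
    rw [inner_smul_right, inv_mul_eq_div, le_div_iff₀ hn, one_mul, real_inner_comm]
    have e : ‖u‖⁻¹ * ‖u‖ ^ 2 = ‖u‖ := by field_simp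
    linarith
  have h3 := norm_sub_sq_real x (‖u‖⁻¹ • u)
  rw [hun] at h3
  have h4 : ‖x - ‖u‖⁻¹ • u‖ ^ 2 ≤ 0 := by nlinarith [norm_nonneg x]
  rw [← sub_eq_zero, ← norm_eq_zero]
  exact pow_eq_zero_iff two_ne_zero |>.1 (le_antisymm h4 (sq_nonneg _))

/-- Homothetic curves move in the same direction, and a non-zero velocity would force both momenta
to be the same unit vector. -/
theorem IsRightBilliardLoop.rest_of_momenta_ne {b : ℝ} (hb : 0 < b) {y : Vec n}
    (h₁ : IsRightBilliardLoop K₁ (euclideanUnitBall n) q p₁)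
    (h₂ : IsRightBilliardLoop K₂ (euclideanUnitBall n) (fun t => b • q t + y) p₂) {s : ℝ}
    (hs : p₁ s ≠ p₂ s) : HasDerivWithinAt q 0 (Ioi s) s := by
  obtain ⟨v, hv, h1, -⟩ := h₁.deriv_right s
  obtain ⟨w, hw, h2, -⟩ := h₂.deriv_right s
  have h3 : w.1 = b • v.1 := (uniqueDiffWithinAt_Ioi s).eq_deriv _ h2 ((h1.const_smul b).add_const y)
  by_cases h0 : v.1 = 0
  · rwa [h0] at h1
  have hv0 : -v.1 ≠ 0 := neg_ne_zero.2 h0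
  have h4 : -v.1 ∈ outwardNormalCone (euclideanUnitBall n) (p₂ s) := by
    have := smul_mem_outwardNormalCone (inv_pos.2 hb).le hw.2.1
    rwa [h3, smul_neg, inv_smul_smul₀ hb.ne'] at this
  exact absurd ((eq_of_normal_unitBall (h₁.mem_right s) hv.2.1 hv0).trans
    (eq_of_normal_unitBall (h₂.mem_right s) h4 hv0).symm) hs

theorem IsRightBilliardLoop.eq_of_momenta_ne {b : ℝ} (hb : 0 < b) {y : Vec n}
    (h₁ : IsRightBilliardLoop K₁ (euclideanUnitBall n) q p₁)
    (h₂ : IsRightBilliardLoop K₂ (euclideanUnitBall n) (fun t => b • q t + y) p₂) {α β : ℝ}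
    (hαβ : α < β) (hne : ∀ s ∈ Ioo α β, p₁ s ≠ p₂ s) : ∀ s ∈ Icc α β, q s = q β := by
  have h3 : ∀ s ∈ Ioc α β, q s = q β := fun s hs =>
    (constant_of_has_deriv_right_zero h₁.continuous_q.continuousOn (fun r hr =>
      (h₁.rest_of_momenta_ne hb h₂ (hne r ⟨hs.1.trans_le hr.1, hr.2⟩)).Ici_of_Ioi) β
      ⟨hs.2, le_rfl⟩).symm
  intro s hs
  rcases eq_or_lt_of_le hs.1 with rfl | h
  · refine tendsto_nhds_unique
      ((h₁.continuous_q.tendsto α).mono_left (nhdsWithin_le_nhds (s := Ioi α))) ?_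
    refine tendsto_const_nhds.congr' ?_
    filter_upwards [Ioo_mem_nhdsGT hαβ] with r hr
    exact (h3 r ⟨hr.1, hr.2.le⟩).symm
  · exact h3 s ⟨h, hs.2⟩

/-- If a Euclidean billiard trajectory in the smooth body `K₁` is homothetic to one in `K₂`, then the
momentum of the former moves along common normals. -/
theorem IsRightBilliardLoop.normal_mem_of_homothetic (hK₁ : IsSmoothConvexBody K₁)
    (hK₂ : IsConvexBody K₂) {b : ℝ} (hb : 0 < b) {y : Vec n} (hq : ∀ t, q t ∈ K₁)
    (h₁ : IsRightBilliardLoop K₁ (euclideanUnitBall n) q p₁)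
    (h₂ : IsRightBilliardLoop K₂ (euclideanUnitBall n) (fun t => b • q t + y) p₂) {t : ℝ} {u : Vec n}
    (hu : u ∈ outwardNormalCone K₁ (q t)) (hd : HasDerivWithinAt p₁ u (Ioi t) t) :
    u ∈ outwardNormalCone K₂ (b • q t + y) := by
  by_cases hfreq : ∃ᶠ s in 𝓝[>] t, p₁ s = p₂ s
  -- If times of agreement accumulate at `t` from the right, the right derivatives of the momenta
  -- agree.
  · obtain ⟨w, hw, -, hd'⟩ := h₂.deriv_right t
    have hdiff := hd.sub hd'
    have h0 : p₁ t - p₂ t = 0 := by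
      have hlim : Tendsto (fun s => p₁ s - p₂ s) (𝓝[>] t) (𝓝 (p₁ t - p₂ t)) :=
        ((h₁.continuous_p.sub h₂.continuous_p).tendsto t).mono_left nhdsWithin_le_nhds
      refine isClosed_singleton.mem_of_frequently_of_tendsto (hfreq.mono fun s hs => ?_) hlim
      simp [hs]
    have h3 : u - w.2 = 0 := by
      refine isClosed_singleton.mem_of_frequently_of_tendsto (hfreq.mono fun s hs => ?_)
        ((hasDerivWithinAt_iff_tendsto_slope' (lt_irrefl t)).1 hdiff)
      simp [slope, h0, hs]
    rw [sub_eq_zero.1 h3]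
    exact hw.2.2
  rw [not_frequently] at hfreq
  obtain ⟨r, hr, hrS⟩ := mem_nhdsGT_iff_exists_Ioo_subset.1 hfreq
  have hr : t < r := hr
  set S : Set ℝ := {s | p₁ s = p₂ s} with hS
  have hSc : IsClosed S := isClosed_eq h₁.continuous_p h₂.continuous_p
  -- Without any agreement `q` would rest for a whole period, and its momentum would have a non-zero
  -- net change over that period.
  have hSne : S.Nonempty := by
    by_contra hemp
    have h3 : ∀ s ∈ Icc (0 : ℝ) 1, q s = q 1 :=
      h₁.eq_of_momenta_ne hb h₂ one_pos fun s _ hs => hemp ⟨s, hs⟩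
    refine (h₁.normal_of_rest hK₁.isConvexBody one_pos h3).2 ?_
    have := h₁.periodic_p 0
    rw [zero_add] at this
    rw [this, sub_self]
  have hper : Function.Periodic (fun s => p₁ s - p₂ s) 1 := h₁.periodic_p.sub h₂.periodic_p
  obtain ⟨s₀, hs₀⟩ := hSne
  have hs₀ : p₁ s₀ - p₂ s₀ = 0 := sub_eq_zero.2 hs₀
  obtain ⟨l, hl, hl'⟩ := hper.exists_mem_Ico one_pos s₀ (t - 1)
  obtain ⟨k, hk, hk'⟩ := hper.exists_mem_Ico one_pos s₀ r
  have hlS : l ∈ S ∩ Iic t :=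
    ⟨sub_eq_zero.1 (hl'.symm.trans hs₀), (by linarith [hl.2] : l ≤ t)⟩
  have hkS : k ∈ S ∩ Ici r := ⟨sub_eq_zero.1 (hk'.symm.trans hs₀), hk.1⟩
  have hbl : BddAbove (S ∩ Iic t) := ⟨t, fun s hs => hs.2⟩
  have hbk : BddBelow (S ∩ Ici r) := ⟨r, fun s hs => hs.2⟩
  have hα := (hSc.inter isClosed_Iic).csSup_mem ⟨l, hlS⟩ hbl
  have hβ := (hSc.inter isClosed_Ici).csInf_mem ⟨k, hkS⟩ hbk
  -- The last agreement up to `t` and the next one after it bound an interval on which `q` rests.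
  set α := sSup (S ∩ Iic t)
  set β := sInf (S ∩ Ici r)
  have hαt : α ≤ t := hα.2
  have htβ : t < β := hr.trans_le hβ.2
  have hαβ : α < β := hαt.trans_lt htβ
  have hrest := h₁.eq_of_momenta_ne hb h₂ hαβ fun s hs hsS => by
    rcases le_or_gt s t with h | h
    · exact absurd (le_csSup hbl ⟨hsS, h⟩) (not_le.2 hs.1)
    rcases lt_or_ge s r with h' | h'
    · exact hrS ⟨h, h'⟩ hsS
    · exact absurd (csInf_le hbk ⟨hsS, h'⟩) (not_le.2 hs.2)
  obtain ⟨hN₁, hne⟩ := h₁.normal_of_rest hK₁.isConvexBody hαβ hrest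
  have hN₂ := (h₂.normal_of_rest hK₂ hαβ (x := b • q β + y) fun s hs => by rw [hrest s hs]).1
  rw [hrest t ⟨hαt, htβ.le⟩] at hu ⊢
  -- Smoothness of `K₁`: `u` is a multiple of the total jump, which is the same for both momenta and
  -- hence normal to `K₂` too.
  obtain ⟨a, ha, rfl⟩ := hK₁.exists_smul_eq (hq β) hu hN₁ hne
  refine smul_mem_outwardNormalCone ha ?_
  have e1 : p₁ α = p₂ α := hα.1
  have e2 : p₁ β = p₂ β := hβ.1
  rwa [e1, e2]

theorem mem_outwardNormalCone_add {x₁ x₂ u : Vec n} (h₁ : u ∈ outwardNormalCone K₁ x₁)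
    (h₂ : u ∈ outwardNormalCone K₂ x₂) : u ∈ outwardNormalCone (K₁ + K₂) (x₁ + x₂) := by
  rintro _ ⟨y₁, hy₁, y₂, hy₂, rfl⟩
  rw [add_sub_add_comm, inner_add_right]
  exact add_nonneg (h₁ y₁ hy₁) (h₂ y₂ hy₂)

/-- Only right derivatives are controlled for the sum curve, which is all that the lower bound for
its length needs. -/
theorem IsRightBilliardLoop.add_homothetic (hK₁ : IsSmoothConvexBody K₁)
    (hK₂ : IsConvexBody K₂) {b : ℝ} (hb : 0 < b) {y : Vec n} (hq : ∀ t, q t ∈ K₁)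
    (h₁ : IsRightBilliardLoop K₁ (euclideanUnitBall n) q p₁)
    (h₂ : IsRightBilliardLoop K₂ (euclideanUnitBall n) (fun t => b • q t + y) p₂) :
    IsRightBilliardLoop (K₁ + K₂) (euclideanUnitBall n) (fun t => (1 + b) • q t + y) p₁ where
  continuous_q := by have := h₁.continuous_q; fun_prop
  continuous_p := h₁.continuous_p
  periodic_q := fun t => by simp only [h₁.periodic_q t]
  periodic_p := h₁.periodic_p
  mem_right := h₁.mem_right
  ae_differentiableAt := h₁.ae_differentiableAt.mono fun t ht => (ht.const_smul (1 + b)).add_const y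
  deriv_right := fun t => by
    obtain ⟨v, hv, h3, h4⟩ := h₁.deriv_right t
    have hb1 : 0 < 1 + b := by linarith
    refine ⟨((1 + b) • v.1, v.2), ⟨?_, ?_, ?_⟩, (h3.const_smul (1 + b)).add_const y, h4⟩
    · intro h0
      have hfst : (1 + b) • v.1 = 0 := congrArg Prod.fst h0
      have hsnd : v.2 = 0 := congrArg Prod.snd h0
      exact hv.1 (Prod.ext ((smul_eq_zero.1 hfst).resolve_left hb1.ne') hsnd)
    · have := smul_mem_outwardNormalCone hb1.le hv.2.1
      rwa [smul_neg] at this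
    · have := mem_outwardNormalCone_add hv.2.2
        (h₁.normal_mem_of_homothetic hK₁ hK₂ hb hq h₂ hv.2.2 h4)
      rwa [show q t + (b • q t + y) = (1 + b) • q t + y by
        rw [add_smul, one_smul, add_assoc]] at this

/-- The sum curve is a billiard loop in `K₁ + K₂` whose length is the sum of the two minimal
lengths. -/
theorem xi_add_le_of_common_shortest (hn : 1 ≤ n) (hK₁ : IsSmoothConvexBody K₁)
    (hK₂ : IsConvexBody K₂) {c : ℝ → Vec n} {a₁ a₂ : ℝ} {x₁ x₂ : Vec n} (ha₁ : 0 < a₁)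
    (ha₂ : 0 < a₂)
    (h₁ : IsShortestBilliardTrajectory K₁ (euclideanUnitBall n) (fun t => a₁ • c t + x₁))
    (h₂ : IsShortestBilliardTrajectory K₂ (euclideanUnitBall n) (fun t => a₂ • c t + x₂)) :
    xi (K₁ + K₂) ≤ xi K₁ + xi K₂ := by
  have hT := isConvexBody_euclideanUnitBall n
  obtain ⟨p₁, hp₁⟩ := h₁.1
  obtain ⟨p₂, hp₂⟩ := h₂.1
  have hb : 0 < a₂ / a₁ := div_pos ha₂ ha₁
  have hq₂ : (fun t => a₂ • c t + x₂) =
      fun t => (a₂ / a₁) • (a₁ • c t + x₁) + (x₂ - (a₂ / a₁) • x₁) := by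
    ext1 t
    rw [smul_add, smul_smul, div_mul_cancel₀ _ ha₁.ne']
    abel
  have h3 := (hp₁.isRightBilliardLoop hK₁.isConvexBody hT).add_homothetic hK₁ hK₂ hb
    (fun t => (hp₁.mem_prod hK₁.isConvexBody hT t).1)
    (p₂ := p₂) (by rw [← hq₂]; exact hp₂.isRightBilliardLoop hK₂ hT)
  have h4 := h3.minkowskiXi_le hn (hK₁.isConvexBody.add hK₂) hT
  have h5 := billiardLength_smul_add hT hb.le (x₂ - (a₂ / a₁) • x₁) fun t => a₁ • c t + x₁
  rw [← hq₂] at h5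
  rw [billiardLength_smul_add hT (by positivity), add_mul, one_mul, ← h5] at h4
  rwa [xi, xi, xi, h₁.minkowskiXi_eq, h₂.minkowskiXi_eq]

end CommonTrajectory

end

theorem mainTheorem2 {n : ℕ} (hn : 1 ≤ n) (K₁ K₂ : Set (EuclideanSpace ℝ (Fin n)))
    (hK₁ : IsSmoothConvexBody K₁) (hK₂ : IsSmoothConvexBody K₂) :
    -- the shortest Euclidean billiard trajectories exist
    (∀ K ∈ ({K₁, K₂, K₁ + K₂} : Set (Set (EuclideanSpace ℝ (Fin n)))),
      ∃ q, IsShortestBilliardTrajectory K (euclideanUnitBall n) q) ∧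
    -- the Euclidean inequality
    xi (K₁ + K₂) ≥ xi K₁ + xi K₂ ∧
    -- the equality case
    (xi (K₁ + K₂) = xi K₁ + xi K₂ ↔
      ∃ (c : ℝ → EuclideanSpace ℝ (Fin n)) (a₁ a₂ : ℝ) (x₁ x₂ : EuclideanSpace ℝ (Fin n)),
        0 < a₁ ∧ 0 < a₂ ∧
        IsShortestBilliardTrajectory K₁ (euclideanUnitBall n) (fun t => a₁ • c t + x₁) ∧
        IsShortestBilliardTrajectory K₂ (euclideanUnitBall n) (fun t => a₂ • c t + x₂)) ∧
    -- the Minkowski version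
    (∀ T : Set (EuclideanSpace ℝ (Fin n)), IsSmoothConvexBody T →
      (∀ K ∈ ({K₁, K₂, K₁ + K₂} : Set (Set (EuclideanSpace ℝ (Fin n)))),
        ∃ q, IsShortestBilliardTrajectory K T q) ∧
      minkowskiXi T (K₁ + K₂) ≥ minkowskiXi T K₁ + minkowskiXi T K₂) := by
  have h₁ := hK₁.isConvexBody
  have h₂ := hK₂.isConvexBody
  have hB := isConvexBody_euclideanUnitBall n
  have hbody : ∀ K ∈ ({K₁, K₂, K₁ + K₂} : Set (Set (EuclideanSpace ℝ (Fin n)))),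
      IsConvexBody K := by
    rintro K (rfl | rfl | rfl)
    exacts [h₁, h₂, h₁.add h₂]
  have hadd := minkowskiXi_add_le hn h₁ h₂ hB
  refine ⟨fun K hK => exists_isShortestBilliardTrajectory hn (hbody K hK) hB, hadd,
    ⟨exists_common_shortest_of_minkowskiXi_add_eq hn h₁ h₂ hB, ?_⟩, fun T hT =>
    ⟨fun K hK => exists_isShortestBilliardTrajectory hn (hbody K hK) hT.isConvexBody,
      minkowskiXi_add_le hn h₁ h₂ hT.isConvexBody⟩⟩
  rintro ⟨c, a₁, a₂, x₁, x₂, ha₁, ha₂, hs₁, hs₂⟩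
  exact le_antisymm (xi_add_le_of_common_shortest hn hK₁ h₂ ha₁ ha₂ hs₁ hs₂) hadd
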